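/- Let $G$ range over finite simple graphs, not necessarily connected. The Harary index of $G$ is $$H(G)=\sum_{\{u,v\}\subseteq V(G),\ u\neq v}\frac{1}{d_G(u,v)},$$ where $d_G$ is the graph distance and $1/d_G(u,v)$ is read as $0$ if $u$ and $v$ lie in different components. A cut vertex of $G$ is a vertex whose removal increases the number of connected components. Let $n,k$ be integers with $0\le k\le n-2$. Let $\mathbf{G}_{n,k}$ be the graph obtained from the complete graph $K_{n-k}$ by attaching at each vertex $v_i$ $(1\le i\le n-k)$ a path with $l_i\ge 0$ edges, one end of which is identified with $v_i$, where the paths are otherwise disjoint, $l_1+\dots+l_{n-k}=k$, and the lengths are almost equal, i.e. $|l_i-l_j|\le 1$ for all $i,j$. Such lengths exist, and, for every choice of them, $\mathbf{G}_{n,k}$ has $n$ vertices and exactly $k$ cut vertices, and every graph $G$ with $n$ vertices and exactly $k$ cut vertices satisfies $$H(G)\le H(\mathbf{G}_{n,k}),$$ with equality if and only if $G$ is isomorphic to $\mathbf{G}_{n,k}$. -/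

import Mathlib

namespace HararyCut

/-- A vertex `v` of a (finite) graph is a cut vertex if deleting it increases the number of
connected components. -/
def IsCutVertex {V : Type*} (G : SimpleGraph V) (v : V) : Prop :=
  Nat.card G.ConnectedComponent < Nat.card (G.induce ({v}ᶜ : Set V)).ConnectedComponent

/-- The number of cut vertices of a (finite) graph. -/
noncomputable def numCutVertices {V : Type*} (G : SimpleGraph V) : ℕ :=
  {v : V | IsCutVertex G v}.ncard

/-- The Harary index: the sum of `1 / d(u, v)` over all unordered pairs of distinct vertices,
where pairs of vertices in different components contribute `0`. It is written as half of the
sum over ordered pairs; `SimpleGraph.dist u v = 0` when `u = v` or when `u` and `v` lie in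
different components, so exactly these pairs contribute `0⁻¹ = 0`. -/
noncomputable def hararyIndex {V : Type*} [Fintype V] (G : SimpleGraph V) : ℝ :=
  (1 / 2) * ∑ u : V, ∑ v : V, (G.dist u v : ℝ)⁻¹

/-- The graph obtained from the complete graph on `Fin m` by attaching at each vertex `i` a path
with `l i` edges (the path is trivial if `l i = 0`). The vertices of the `i`-th path are
`⟨i, 0⟩, ⟨i, 1⟩, …, ⟨i, l i⟩`, and `⟨i, 0⟩` is the vertex `i` of the complete graph. -/
def completeWithPaths {m : ℕ} (l : Fin m → ℕ) : SimpleGraph (Σ i : Fin m, Fin (l i + 1)) where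
  Adj x y :=
    (x.1 ≠ y.1 ∧ x.2.val = 0 ∧ y.2.val = 0) ∨
      (x.1 = y.1 ∧ (x.2.val + 1 = y.2.val ∨ y.2.val + 1 = x.2.val))
  symm := ⟨by
    rintro x y (⟨h, hx, hy⟩ | ⟨h, h'⟩)
    · exact Or.inl ⟨h.symm, hy, hx⟩
    · exact Or.inr ⟨h.symm, h'.symm⟩⟩
  loopless := ⟨by
    rintro x (⟨h, -⟩ | ⟨-, h⟩)
    · exact h rfl
    · omega⟩

/-- The lengths `l i` are almost equal: any two of them differ by at most one. -/
def AlmostEqual {m : ℕ} (l : Fin m → ℕ) : Prop :=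
  ∀ i j, l i ≤ l j + 1

end HararyCut

namespace HararyCut

/-! Put m = n - k, the number of vertices that are not cut vertices; it is also the number of legs
(attached paths) of the extremal graph. The bound is proved for a larger class, graphs `G` with a
path of `t` edges attached at a non-cut vertex `x` (`tailIndex`), by induction on the number of
vertices of `G`: `x` is deleted and its neighbours are made a clique (`elim`). This creates no cut
vertex, lengthens no distance and preserves separation by the remaining vertices. There are two
cases.

If some cut vertex c is lost, c is the only neighbour of `x` (`adj_iff_of_not_isCutVertex_elim`).
Then `x` joins the tail: c is a non-cut vertex of the smaller graph, carries a tail of `t + 1`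
edges, and m is unchanged.

If no cut vertex is lost, m drops by one. Pairs away from `x` are handled by induction. For pairs of
a vertex with `x` or its tail, only the sizes of the spheres around `x` matter. Each sphere has at
most m - 1 vertices: every vertex y on it is, or hides from `x`, a non-cut vertex, and these are
distinct for distinct y (`card_sphere_add_one_le`). Almost equal legs fill m - 1 places per level as
early as possible, so they are optimal (`sum_levels_le_almostEqual`). Thus the index is at most that
of a clique with m legs, one of them of length `t`, and balancing the lengths only increases it
(`legIndex_le`).

If equality holds, the two steps can be reversed: `x` either extends a leg or is a new clique
vertex, so `G` with its tail is a clique with legs (`LegCoordinates`). The lengths are then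
compared: with at least three legs balancing is strict, while with two legs every choice of lengths
gives the same path. -/

/-! ### The index of a clique with legs as a function of the lengths -/

/-- Harmonic numbers. -/
noncomputable def harm (t : ℕ) : ℝ := ∑ s ∈ Finset.range t, ((s : ℝ) + 1)⁻¹

/-- The Harary index of a path on `t` vertices. -/
noncomputable def pathIndex (t : ℕ) : ℝ := ∑ s ∈ Finset.range t, harm s

/-- The contribution of the pairs of vertices on two different attached paths. -/
noncomputable def crossIndex (a b : ℕ) : ℝ :=
  ∑ s ∈ Finset.range (a + 1), ∑ u ∈ Finset.range (b + 1), ((s : ℝ) + u + 1)⁻¹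

/-- The Harary index of a complete graph with attached paths, as a function of the lengths. -/
noncomputable def legIndex {m : ℕ} (l : Fin m → ℕ) : ℝ :=
  ∑ i, pathIndex (l i + 1) + (1 / 2) * ∑ i, ∑ j, if i = j then 0 else crossIndex (l i) (l j)

lemma crossIndex_comm (a b : ℕ) : crossIndex a b = crossIndex b a := by
  unfold crossIndex
  rw [Finset.sum_comm]
  refine Finset.sum_congr rfl fun u _ => Finset.sum_congr rfl fun s _ => ?_
  rw [add_comm (s : ℝ)]

lemma harm_add (a b : ℕ) :
    harm (a + b) = harm a + ∑ u ∈ Finset.range b, ((a : ℝ) + u + 1)⁻¹ := by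
  unfold harm
  rw [Finset.sum_range_add]
  push_cast
  rfl

lemma crossIndex_succ_left (a b : ℕ) :
    crossIndex (a + 1) b = crossIndex a b + (harm (a + b + 2) - harm (a + 1)) := by
  have h := harm_add (a + 1) (b + 1)
  rw [show a + 1 + (b + 1) = a + b + 2 by ring] at h
  rw [h]
  unfold crossIndex
  rw [Finset.sum_range_succ _ (a + 1)]
  ring

/-- Strict concavity in the first length: the increment is the sum of the terms 1 / (a + u + 2),
each decreasing in `a`. -/
lemma crossIndex_succ_left_lt {a a' : ℕ} (haa : a < a') (b : ℕ) :
    crossIndex (a' + 1) b - crossIndex a' b < crossIndex (a + 1) b - crossIndex a b := by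
  unfold crossIndex
  rw [Finset.sum_range_succ _ (a' + 1), Finset.sum_range_succ _ (a + 1)]
  simp only [add_sub_cancel_left]
  refine Finset.sum_lt_sum_of_nonempty (by simp) fun u _ => ?_
  have : (a : ℝ) < a' := by exact_mod_cast haa
  push_cast
  gcongr

lemma pathIndex_succ (t : ℕ) : pathIndex (t + 1) = pathIndex t + harm t :=
  Finset.sum_range_succ _ _

/-- Two legs joined at their roots form a path on `a + b + 3` vertices, and both sides are its
index, with the path cut at two consecutive edges. -/
lemma pair_succ (a b : ℕ) :
    pathIndex (a + 2) + pathIndex (b + 1) + crossIndex (a + 1) b =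
      pathIndex (a + 1) + pathIndex (b + 2) + crossIndex a (b + 1) := by
  rw [crossIndex_comm a (b + 1), crossIndex_succ_left, crossIndex_succ_left,
    pathIndex_succ (a + 1), pathIndex_succ (b + 1), crossIndex_comm b a, add_comm b a]
  ring

/-- Splitting off two indices. -/
lemma legIndex_split {m : ℕ} (l : Fin m → ℕ) {i j : Fin m} (hij : i ≠ j) :
    legIndex l = pathIndex (l i + 1) + pathIndex (l j + 1) + crossIndex (l i) (l j) +
      ∑ p ∈ (Finset.univ.erase i).erase j, (crossIndex (l i) (l p) + crossIndex (l j) (l p)) +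
      (∑ p ∈ (Finset.univ.erase i).erase j, pathIndex (l p + 1) +
        (1 / 2) * ∑ p ∈ (Finset.univ.erase i).erase j, ∑ p' ∈ (Finset.univ.erase i).erase j,
          if p = p' then 0 else crossIndex (l p) (l p')) := by
  have key : ∀ f : Fin m → ℝ,
      ∑ p, f p = f i + (f j + ∑ p ∈ (Finset.univ.erase i).erase j, f p) := by
    intro f
    rw [Finset.add_sum_erase _ f (by simp [hij.symm]), Finset.add_sum_erase _ f (by simp)]
  unfold legIndex
  rw [key fun p => pathIndex (l p + 1), key fun p => ∑ j, if p = j then 0 else crossIndex (l p) (l j)]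
  rw [key fun p => if i = p then 0 else crossIndex (l i) (l p),
    key fun p => if j = p then 0 else crossIndex (l j) (l p)]
  have e : ∑ p ∈ (Finset.univ.erase i).erase j, ∑ p', (if p = p' then 0 else crossIndex (l p) (l p'))
      = ∑ p ∈ (Finset.univ.erase i).erase j, (crossIndex (l i) (l p) + crossIndex (l j) (l p)) +
       ∑ p ∈ (Finset.univ.erase i).erase j, ∑ p' ∈ (Finset.univ.erase i).erase j,
          if p = p' then 0 else crossIndex (l p) (l p') := by
    rw [← Finset.sum_add_distrib]
    refine Finset.sum_congr rfl fun p hp => ?_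
    rw [key fun p' => if p = p' then 0 else crossIndex (l p) (l p')]
    simp only [Finset.mem_erase, Finset.mem_univ, and_true] at hp
    rw [if_neg hp.2, if_neg hp.1, crossIndex_comm (l p) (l i), crossIndex_comm (l p) (l j)]
    ring
  rw [e]
  have e1 : ∀ q : Fin m, q = i ∨ q = j → ∑ p ∈ (Finset.univ.erase i).erase j,
      (if q = p then 0 else crossIndex (l q) (l p)) =
      ∑ p ∈ (Finset.univ.erase i).erase j, crossIndex (l q) (l p) := by
    intro q hq
    refine Finset.sum_congr rfl fun p hp => ?_
    simp only [Finset.mem_erase, Finset.mem_univ, and_true] at hp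
    rw [if_neg]
    rintro rfl
    tauto
  rw [e1 i (Or.inl rfl), e1 j (Or.inr rfl), Finset.sum_add_distrib]
  simp only [if_true, if_neg hij, if_neg hij.symm, crossIndex_comm (l j) (l i)]
  ring

/-- Moving the end vertex of a path to the end of a path that is shorter by at least two. -/
lemma legIndex_transfer {m : ℕ} (l l' : Fin m → ℕ) {i j : Fin m} (hij : i ≠ j)
    (h2 : l j + 2 ≤ l i) (hi : l i = l' i + 1) (hj : l' j = l j + 1)
    (hp : ∀ p, p ≠ i → p ≠ j → l' p = l p) :
    legIndex l ≤ legIndex l' ∧ (3 ≤ m → legIndex l < legIndex l') := by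
  have hp' : ∀ p ∈ (Finset.univ.erase i).erase j, l' p = l p := by
    intro p h
    simp only [Finset.mem_erase, Finset.mem_univ, and_true] at h
    exact hp p h.2 h.1
  rw [legIndex_split l hij, legIndex_split l' hij]
  have e1 : ∑ p ∈ (Finset.univ.erase i).erase j, pathIndex (l' p + 1) =
      ∑ p ∈ (Finset.univ.erase i).erase j, pathIndex (l p + 1) :=
    Finset.sum_congr rfl fun p h => by rw [hp' p h]
  have e2 : ∑ p ∈ (Finset.univ.erase i).erase j, ∑ p' ∈ (Finset.univ.erase i).erase j,
          (if p = p' then 0 else crossIndex (l' p) (l' p')) =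
      ∑ p ∈ (Finset.univ.erase i).erase j, ∑ p' ∈ (Finset.univ.erase i).erase j,
          if p = p' then 0 else crossIndex (l p) (l p') :=
    Finset.sum_congr rfl fun p h => Finset.sum_congr rfl fun p' h' => by
      rw [hp' p h, hp' p' h']
  have e3 : ∑ p ∈ (Finset.univ.erase i).erase j, (crossIndex (l' i) (l' p) + crossIndex (l' j) (l' p)) =
      ∑ p ∈ (Finset.univ.erase i).erase j, (crossIndex (l' i) (l p) + crossIndex (l' j) (l p)) :=
    Finset.sum_congr rfl fun p h => by rw [hp' p h]
  -- The two legs involved form a path of unchanged length. The whole gain comes from third legs,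
  -- which is why strictness needs `3 ≤ m`.
  have e4 := pair_succ (l' i) (l j)
  have hlt : ∀ p, crossIndex (l i) (l p) + crossIndex (l j) (l p) <
      crossIndex (l' i) (l p) + crossIndex (l' j) (l p) := by
    intro p
    have := crossIndex_succ_left_lt (a := l j) (a' := l' i) (by omega) (l p)
    rw [hi, hj]
    linarith
  rw [e1, e2, e3]
  simp only [hi, hj, add_assoc, Nat.reduceAdd] at e4 hlt ⊢
  constructor
  · have := Finset.sum_le_sum (s := (Finset.univ.erase i).erase j) fun p _ => (hlt p).le
    linarith
  · intro h3
    have hne : ((Finset.univ.erase i).erase j).Nonempty := by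
      rw [← Finset.card_pos, Finset.card_erase_of_mem (by simp [hij.symm]),
        Finset.card_erase_of_mem (by simp)]
      simp only [Finset.card_univ, Fintype.card_fin]
      omega
    have := Finset.sum_lt_sum_of_nonempty hne fun p _ => hlt p
    linarith

lemma legIndex_comp_perm {m : ℕ} (l : Fin m → ℕ) (σ : Equiv.Perm (Fin m)) :
    legIndex (l ∘ σ) = legIndex l := by
  unfold legIndex
  congr 1
  · exact Equiv.sum_comp σ fun i => pathIndex (l i + 1)
  · congr 1
    rw [← Equiv.sum_comp σ fun i => ∑ j, if i = j then 0 else crossIndex (l i) (l j)]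
    refine Finset.sum_congr rfl fun i _ => ?_
    rw [← Equiv.sum_comp σ fun j => if σ i = j then 0 else crossIndex (l (σ i)) (l j)]
    simp

/-! ### Almost equal lengths and balancing -/

/-- Each value is the minimum or one more, and the minimum is attained, so fewer than `m` values are
larger. The minimum is thus the quotient, and the number of larger values the remainder, of the sum
divided by `m`. Hence the sum determines the lengths up to order. -/
lemma AlmostEqual.spec {m : ℕ} {l : Fin m → ℕ} (h : AlmostEqual l) :
    (∀ i, l i = (∑ i, l i) / m ∨ l i = (∑ i, l i) / m + 1) ∧
      (Finset.univ.filter fun i => l i = (∑ i, l i) / m + 1).card = (∑ i, l i) % m := by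
  rcases Nat.eq_zero_or_pos m with rfl | hm
  · exact ⟨fun i => i.elim0, by simp⟩
  have : Nonempty (Fin m) := ⟨⟨0, hm⟩⟩
  obtain ⟨i₀, h₀⟩ := Finite.exists_min l
  have h1 : ∀ i, l i = l i₀ + if l i = l i₀ + 1 then 1 else 0 := by
    intro i
    have := h i i₀
    have := h₀ i
    split_ifs <;> omega
  have hs : ∑ i, l i = m * l i₀ + (Finset.univ.filter fun i => l i = l i₀ + 1).card := by
    rw [Finset.sum_congr rfl fun i _ => h1 i, Finset.sum_add_distrib, Finset.sum_boole]
    simp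
  have hlt : (Finset.univ.filter fun i => l i = l i₀ + 1).card < m := by
    have : (Finset.univ.filter fun i => l i = l i₀ + 1) ⊂ Finset.univ :=
      Finset.filter_ssubset.2 ⟨i₀, by simp⟩
    simpa using Finset.card_lt_card this
  have hq : (∑ i, l i) / m = l i₀ := by
    rw [hs, Nat.mul_add_div hm, Nat.div_eq_of_lt hlt, add_zero]
  have hr : (∑ i, l i) % m = (Finset.univ.filter fun i => l i = l i₀ + 1).card := by
    rw [hs, Nat.mul_add_mod, Nat.mod_eq_of_lt hlt]
  rw [hq, hr]
  refine ⟨fun i => ?_, rfl⟩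
  have := h1 i
  split_ifs at this <;> omega

lemma exists_perm_of_card_fiber {ι : Type*} [Fintype ι] {α : Type*} [DecidableEq α] (f g : ι → α)
    (h : ∀ a, (Finset.univ.filter fun i => f i = a).card =
      (Finset.univ.filter fun i => g i = a).card) :
    ∃ σ : Equiv.Perm ι, g = f ∘ σ := by
  have e : ∀ a, Nonempty ({i // g i = a} ≃ {i // f i = a}) := fun a => by
    refine Fintype.card_eq.1 ?_
    rw [Fintype.card_subtype, Fintype.card_subtype, h]
  refine ⟨(Equiv.sigmaFiberEquiv g).symm.trans
    ((Equiv.sigmaCongrRight fun a => (e a).some).trans (Equiv.sigmaFiberEquiv f)), ?_⟩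
  funext i
  simp only [Function.comp, Equiv.trans_apply]
  exact (((e (g i)).some ⟨i, rfl⟩).2).symm

lemma AlmostEqual.exists_perm {m : ℕ} {l l' : Fin m → ℕ} (h : AlmostEqual l) (h' : AlmostEqual l')
    (hs : ∑ i, l i = ∑ i, l' i) : ∃ σ : Equiv.Perm (Fin m), l' = l ∘ σ := by
  apply exists_perm_of_card_fiber
  obtain ⟨h1, h2⟩ := h.spec
  obtain ⟨h1', h2'⟩ := h'.spec
  rw [← hs] at h1' h2'
  have hc : ∀ {f : Fin m → ℕ} {q : ℕ}, (∀ i, f i = q ∨ f i = q + 1) →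
      (Finset.univ.filter fun i => f i = q).card +
        (Finset.univ.filter fun i => f i = q + 1).card = m := by
    intro f q hf
    rw [← Finset.card_union_of_disjoint, ← Finset.filter_or, Finset.filter_true_of_mem]
    · simp
    · exact fun i _ => hf i
    · exact Finset.disjoint_filter.2 fun i _ h h' => by omega
  intro a
  by_cases ha : a = (∑ i, l i) / m + 1
  · rw [ha, h2, h2']
  by_cases ha' : a = (∑ i, l i) / m
  · have := hc h1
    have := hc h1'
    rw [ha']
    omega
  · rw [Finset.filter_false_of_mem, Finset.filter_false_of_mem]
    · intro i _
      have := h1' i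
      omega
    · intro i _
      have := h1 i
      omega

lemma exists_almostEqual {m : ℕ} (hm : 0 < m) (k : ℕ) :
    ∃ l : Fin m → ℕ, AlmostEqual l ∧ ∑ i, l i = k := by
  refine ⟨fun i => k / m + if i.val < k % m then 1 else 0, fun i j => by dsimp only; split_ifs <;> omega, ?_⟩
  rw [Finset.sum_add_distrib, Finset.sum_boole]
  have : (Finset.univ.filter fun i : Fin m => i.val < k % m).card = k % m := by
    rw [Fin.card_filter_val_lt]
    have := Nat.mod_lt k hm
    omega
  rw [this]
  simp [Nat.div_add_mod]

lemma exists_almostEqual_legIndex_le {m : ℕ} (l : Fin m → ℕ) :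
    ∃ l' : Fin m → ℕ, AlmostEqual l' ∧ ∑ i, l' i = ∑ i, l i ∧ legIndex l ≤ legIndex l' ∧
      (3 ≤ m → ¬ AlmostEqual l → legIndex l < legIndex l') := by
  -- Each transfer from a leg to one shorter by at least two lowers the sum of squares. The strict
  -- inequality comes from the first transfer alone.
  induction hN : ∑ i, l i ^ 2 using Nat.strong_induction_on generalizing l with
  | _ N ih =>
  by_cases h : AlmostEqual l
  · exact ⟨l, h, rfl, le_rfl, fun _ h' => absurd h h'⟩
  have h' := h
  unfold AlmostEqual at h'
  push Not at h'
  obtain ⟨i, j, hij⟩ := h'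
  have hne : i ≠ j := by
    rintro rfl
    omega
  let l₁ : Fin m → ℕ := Function.update (Function.update l i (l i - 1)) j (l j + 1)
  have hi : l₁ i = l i - 1 := by simp [l₁, hne]
  have hj : l₁ j = l j + 1 := by simp [l₁]
  have hp : ∀ p, p ≠ i → p ≠ j → l₁ p = l p := fun p h1 h2 => by simp [l₁, h1, h2]
  have key : ∀ f : Fin m → ℕ,
      ∑ p, f p = f i + (f j + ∑ p ∈ (Finset.univ.erase i).erase j, f p) := by
    intro f
    rw [Finset.add_sum_erase _ f (by simp [hne.symm]), Finset.add_sum_erase _ f (by simp)]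
  have hrest : ∀ g : ℕ → ℕ, ∑ p ∈ (Finset.univ.erase i).erase j, g (l₁ p) =
      ∑ p ∈ (Finset.univ.erase i).erase j, g (l p) := by
    intro g
    refine Finset.sum_congr rfl fun p h => ?_
    simp only [Finset.mem_erase, Finset.mem_univ, and_true] at h
    rw [hp p h.2 h.1]
  have hsum : ∑ i, l₁ i = ∑ i, l i := by
    rw [key, key l, hrest fun x => x, hi, hj]
    omega
  have hsq : ∑ i, l₁ i ^ 2 < N := by
    rw [← hN, key, key fun p => l p ^ 2, hrest fun x => x ^ 2, hi, hj]
    obtain ⟨a, ha⟩ : ∃ a, l i = a + 1 := ⟨l i - 1, by omega⟩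
    rw [ha] at hij ⊢
    simp only [Nat.add_sub_cancel]
    nlinarith
  obtain ⟨h1, h2⟩ := legIndex_transfer l l₁ hne (by omega) (by omega) hj hp
  obtain ⟨l', ha, hs, hle, -⟩ := ih _ hsq l₁ rfl
  exact ⟨l', ha, hs.trans hsum, h1.trans hle, fun h3 _ => (h2 h3).trans_le hle⟩

theorem legIndex_le {m : ℕ} (l l₀ : Fin m → ℕ) (h₀ : AlmostEqual l₀)
    (hs : ∑ i, l i = ∑ i, l₀ i) :
    legIndex l ≤ legIndex l₀ ∧ (3 ≤ m → legIndex l = legIndex l₀ → AlmostEqual l) := by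
  obtain ⟨l', ha, hs', hle, hlt⟩ := exists_almostEqual_legIndex_le l
  obtain ⟨σ, rfl⟩ := ha.exists_perm h₀ (hs'.trans hs)
  rw [legIndex_comp_perm]
  refine ⟨hle, fun h3 he => ?_⟩
  by_contra h
  exact (hlt h3 h).ne he

/-! ### Comparison of level distributions -/

/-- Summation by parts: for a nonincreasing weight, the sum over a family of levels is determined
by the counting function of the family. -/
lemma sum_levels {α : Type*} [Fintype α] (f : α → ℕ) (φ : ℕ → ℝ) (D : ℕ) (hD : ∀ a, f a ≤ D) :
    ∑ a, φ (f a) = Fintype.card α * φ D +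
      ∑ i ∈ Finset.range D, (φ i - φ (i + 1)) * (Finset.univ.filter fun a => f a ≤ i).card := by
  have h : ∀ a, φ (f a) = φ D + ∑ i ∈ Finset.range D, (φ i - φ (i + 1)) * if f a ≤ i then 1 else 0 := by
    intro a
    have e : ∀ D, f a ≤ D → ∑ i ∈ Finset.range D, (φ i - φ (i + 1)) * (if f a ≤ i then 1 else 0) =
        φ (f a) - φ D := by
      intro D hD
      induction D, hD using Nat.le_induction with
      | base =>
        rw [sub_self]
        refine Finset.sum_eq_zero fun i hi => ?_
        rw [if_neg (by simpa using hi), mul_zero]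
      | succ D hD ih =>
        rw [Finset.sum_range_succ, ih, if_pos hD]
        ring
    rw [e D (hD a)]
    ring
  rw [Finset.sum_congr rfl fun a _ => h a, Finset.sum_add_distrib, Finset.sum_comm]
  congr 1
  · simp
  · refine Finset.sum_congr rfl fun i _ => ?_
    rw [← Finset.mul_sum, Finset.sum_boole]

lemma sum_levels_le {α β : Type*} [Fintype α] [Fintype β] (f : α → ℕ) (g : β → ℕ) (φ : ℕ → ℝ)
    (hφ : ∀ i, φ (i + 1) ≤ φ i) (hc : Fintype.card α = Fintype.card β)
    (h : ∀ i, (Finset.univ.filter fun a => f a ≤ i).card ≤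
      (Finset.univ.filter fun b => g b ≤ i).card) :
    ∑ a, φ (f a) ≤ ∑ b, φ (g b) ∧ ∀ i, φ (i + 1) < φ i → ∑ a, φ (f a) = ∑ b, φ (g b) →
      (Finset.univ.filter fun a => f a ≤ i).card = (Finset.univ.filter fun b => g b ≤ i).card := by
  have key : ∀ i, ∃ D, i < D ∧ (∀ a, f a ≤ D) ∧ ∀ b, g b ≤ D := fun i =>
    ⟨i + 1 + ∑ a, f a + ∑ b, g b, by omega,
      fun a => by have := Finset.single_le_sum (f := f) (by simp) (Finset.mem_univ a); omega,
      fun b => by have := Finset.single_le_sum (f := g) (by simp) (Finset.mem_univ b); omega⟩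
  have hle : ∀ i, (φ i - φ (i + 1)) * ((Finset.univ.filter fun a => f a ≤ i).card : ℝ) ≤
      (φ i - φ (i + 1)) * ((Finset.univ.filter fun b => g b ≤ i).card : ℝ) := fun i =>
    mul_le_mul_of_nonneg_left (by exact_mod_cast h i) (sub_nonneg.2 (hφ i))
  constructor
  · obtain ⟨D, -, h1, h2⟩ := key 0
    rw [sum_levels f φ D h1, sum_levels g φ D h2, hc]
    exact add_le_add_right (Finset.sum_le_sum fun i _ => hle i) _
  · intro i hi he
    obtain ⟨D, hiD, h1, h2⟩ := key i
    rw [sum_levels f φ D h1, sum_levels g φ D h2, hc] at he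
    have := (Finset.sum_eq_sum_iff_of_le fun i _ => hle i).1 (add_left_cancel he) i (by simpa using hiD)
    exact_mod_cast mul_left_cancel₀ (sub_pos.2 hi).ne' this

lemma card_level_sigma {m : ℕ} (l : Fin m → ℕ) (d : ℕ) :
    (Finset.univ.filter fun x : Σ i : Fin m, Fin (l i + 1) => x.2.val + 1 ≤ d).card =
      ∑ i, min (l i + 1) d := by
  rw [← Finset.univ_sigma_univ, Finset.card_filter, Finset.sum_sigma]
  refine Finset.sum_congr rfl fun i _ => ?_
  rw [← Finset.card_filter, ← Fin.card_filter_val_lt]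
  rfl

/-- Among all families with at most `m` elements on each positive level, the family of levels of
almost equal paths is the best one. -/
theorem sum_levels_le_almostEqual {α : Type*} [Fintype α] {m : ℕ} (l : Fin m → ℕ)
    (hl : AlmostEqual l) (f : α → ℕ) (φ : ℕ → ℝ) (hφ : ∀ i, φ (i + 1) ≤ φ i)
    (hc : Fintype.card α = ∑ i, (l i + 1)) (hpos : ∀ a, 1 ≤ f a)
    (h : ∀ i, 1 ≤ i → i ≤ Fintype.card α → (Finset.univ.filter fun a => f a = i).card ≤ m) :
    ∑ a, φ (f a) ≤ ∑ i, ∑ b ∈ Finset.range (l i + 1), φ (b + 1) ∧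
      (φ 2 < φ 1 → ∑ a, φ (f a) = ∑ i, ∑ b ∈ Finset.range (l i + 1), φ (b + 1) →
        (Finset.univ.filter fun a => f a = 1).card = m) := by
  have hcard : Fintype.card α = Fintype.card (Σ i : Fin m, Fin (l i + 1)) := by simp [hc]
  have hsum : ∑ x : (Σ i : Fin m, Fin (l i + 1)), φ (x.2.val + 1) =
      ∑ i, ∑ b ∈ Finset.range (l i + 1), φ (b + 1) := by
    rw [Fintype.sum_sigma]
    exact Finset.sum_congr rfl fun i _ => Fin.sum_univ_eq_sum_range (fun b => φ (b + 1)) (l i + 1)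
  classical
  have hmul : ∀ d, d ≤ Fintype.card α → (Finset.univ.filter fun a => f a ≤ d).card ≤ m * d := by
    intro d
    induction d with
    | zero =>
      intro _
      rw [Finset.filter_false_of_mem]
      · simp
      · intro a _
        have := hpos a
        omega
    | succ d ih =>
      intro hd
      have e : (Finset.univ.filter fun a => f a ≤ d + 1) =
          (Finset.univ.filter fun a => f a ≤ d) ∪ (Finset.univ.filter fun a => f a = d + 1) := by
        ext a
        simp only [Finset.mem_filter, Finset.mem_univ, true_and, Finset.mem_union]
        omega
      rw [e]
      have := Finset.card_union_le (Finset.univ.filter fun a => f a ≤ d)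
        (Finset.univ.filter fun a => f a = d + 1)
      have := ih (by omega)
      have := h (d + 1) (by omega) hd
      rw [mul_add]
      omega
  obtain ⟨hs, -⟩ := hl.spec
  set q := (∑ i, l i) / m
  have hlev : ∀ d, (Finset.univ.filter fun a => f a ≤ d).card ≤
      (Finset.univ.filter fun x : Σ i : Fin m, Fin (l i + 1) => x.2.val + 1 ≤ d).card := by
    intro d
    rw [card_level_sigma]
    -- Up to level `q + 1` every leg contributes `d` vertices, which attains the bound `m * d`.
    -- Otherwise all legs are exhausted and every element is counted.
    by_cases hd : d ≤ q + 1 ∧ d ≤ Fintype.card α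
    · have : ∑ i, min (l i + 1) d = ∑ _i : Fin m, d :=
        Finset.sum_congr rfl fun i _ => by have := hs i; omega
      rw [this]
      simpa using hmul d hd.2
    · have : ∑ i, min (l i + 1) d = ∑ i, (l i + 1) :=
        Finset.sum_congr rfl fun i _ => by
          have := hs i
          have : l i + 1 ≤ ∑ i, (l i + 1) :=
            Finset.single_le_sum (f := fun i => l i + 1) (by simp) (Finset.mem_univ i)
          omega
      rw [this, ← hc]
      exact Finset.card_le_univ _
  obtain ⟨h1, h2⟩ := sum_levels_le f (fun x : Σ i : Fin m, Fin (l i + 1) => x.2.val + 1) φ hφ hcard hlev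
  rw [hsum] at h1 h2
  refine ⟨h1, fun h21 he => ?_⟩
  have := h2 1 h21 he
  rw [card_level_sigma] at this
  simp only [Nat.le_add_left, inf_of_le_right, Finset.sum_const, Finset.card_univ,
    Fintype.card_fin, smul_eq_mul, mul_one] at this
  rw [← this]
  congr 1
  ext a
  have := hpos a
  simp only [Finset.mem_filter, Finset.mem_univ, true_and]
  omega

lemma legIndex_cons {m : ℕ} (t : ℕ) (l : Fin m → ℕ) :
    legIndex (Fin.cons t l : Fin (m + 1) → ℕ) =
      legIndex l + pathIndex (t + 1) + ∑ j, crossIndex t (l j) := by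
  unfold legIndex
  simp only [Fin.sum_univ_succ, Fin.cons_zero, Fin.cons_succ, if_true, Fin.succ_inj,
    (Fin.succ_ne_zero _).symm, Fin.succ_ne_zero, if_false, Finset.sum_add_distrib,
    crossIndex_comm _ t]
  ring

lemma sum_crossIndex {m : ℕ} (t : ℕ) (l : Fin m → ℕ) :
    ∑ j, crossIndex t (l j) = ∑ j, ∑ b ∈ Finset.range (l j + 1),
      ∑ s ∈ Finset.range (t + 1), ((s : ℝ) + ((b + 1 : ℕ) : ℝ))⁻¹ := by
  refine Finset.sum_congr rfl fun j _ => ?_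
  unfold crossIndex
  rw [Finset.sum_comm]
  push_cast
  simp only [add_assoc]

/-! ### Cut vertices, avoiding walks and spheres -/

section

variable {V : Type*} {G : SimpleGraph V}

/-- There is a walk from `a` to `b` that avoids `v`. -/
def AvoidReach (G : SimpleGraph V) (v a b : V) : Prop := ∃ p : G.Walk a b, v ∉ p.support

namespace AvoidReach

lemma refl {v a : V} (h : a ≠ v) : AvoidReach G v a a := ⟨.nil, by simpa using h.symm⟩

lemma of_eq {v a b : V} (h : a = b) (ha : a ≠ v) : AvoidReach G v a b := h ▸ refl ha

lemma symm {v a b : V} : AvoidReach G v a b → AvoidReach G v b a :=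
  fun ⟨p, hp⟩ => ⟨p.reverse, by simpa using hp⟩

lemma trans {v a b c : V} : AvoidReach G v a b → AvoidReach G v b c → AvoidReach G v a c :=
  fun ⟨p, hp⟩ ⟨q, hq⟩ => ⟨p.append q, by simp [SimpleGraph.Walk.mem_support_append_iff, hp, hq]⟩

lemma ne_left {v a b : V} : AvoidReach G v a b → a ≠ v := by
  rintro ⟨p, hp⟩ rfl
  exact hp p.start_mem_support

lemma ne_right {v a b : V} (h : AvoidReach G v a b) : b ≠ v := h.symm.ne_left

lemma of_adj {v a b : V} (h : G.Adj a b) (ha : a ≠ v) (hb : b ≠ v) : AvoidReach G v a b :=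
  ⟨h.toWalk, by simp [ha.symm, hb.symm]⟩

lemma reachable {v a b : V} : AvoidReach G v a b → G.Reachable a b := fun ⟨p, _⟩ => ⟨p⟩

lemma of_not_reachable {v a b : V} (h : G.Reachable a b) (hv : ¬ G.Reachable a v) :
    AvoidReach G v a b := by
  classical
  obtain ⟨p⟩ := h
  exact ⟨p, fun hp => hv ⟨p.takeUntil v hp⟩⟩

lemma of_dist_le {a b z : V} (h : G.Reachable a b) (hz : z ≠ b) (hd : G.dist a b ≤ G.dist a z) :
    AvoidReach G z a b := by
  classical
  obtain ⟨p, hp⟩ := h.exists_walk_length_eq_dist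
  refine ⟨p, fun hzp => ?_⟩
  have h1 := SimpleGraph.Walk.length_takeUntil_lt_length hzp hz
  have h2 := SimpleGraph.dist_le (p.takeUntil z hzp)
  omega

/-- Stop the walk at whichever of `y` and `z` it meets first. -/
lemma or_of_walk {a y z : V} (hzy : z ≠ y) (p : G.Walk a y) :
    AvoidReach G z a y ∨ AvoidReach G y a z := by
  induction p with
  | nil => exact Or.inl (refl hzy.symm)
  | @cons a b y h p ih =>
    by_cases haz : a = z
    · exact Or.inr (of_eq haz fun h => hzy (haz.symm.trans h))
    by_cases hay : a = y
    · exact Or.inl (of_eq hay haz)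
    rcases ih hzy with h' | h'
    · exact Or.inl ((of_adj h haz h'.ne_left).trans h')
    · exact Or.inr ((of_adj h hay h'.ne_left).trans h')

end AvoidReach

lemma reachable_induce_compl_iff {v : V} (a b : ({v}ᶜ : Set V)) :
    (G.induce ({v}ᶜ : Set V)).Reachable a b ↔ AvoidReach G v a b := by
  constructor
  · rintro ⟨p⟩
    induction p with
    | @nil a => exact .refl a.2
    | @cons a b _ h _ ih => exact .trans (.of_adj h a.2 b.2) ih
  · rintro ⟨p, hp⟩
    exact ⟨p.induce _ fun x hx => by
      rw [Set.mem_compl_singleton_iff]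
      rintro rfl
      exact hp hx⟩

/-- The components left after deleting `v` map to those of `G`. If there are more of them, this map
is not injective, which yields the pair. Conversely, a separated pair lies in the component of `v`,
so the map is surjective but not injective. The count drops when `v` is isolated, hence the care
with surjectivity. -/
lemma isCutVertex_iff [Finite V] {v : V} :
    IsCutVertex G v ↔ ∃ a b, a ≠ v ∧ b ≠ v ∧ G.Reachable a b ∧ ¬ AvoidReach G v a b := by
  let f : (G.induce ({v}ᶜ : Set V)).ConnectedComponent → G.ConnectedComponent :=
    SimpleGraph.ConnectedComponent.map (SimpleGraph.Embedding.induce _).toHom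
  have hf : ∀ a : ({v}ᶜ : Set V), f (SimpleGraph.connectedComponentMk _ a) =
    G.connectedComponentMk a := fun a => rfl
  constructor
  · intro h
    have : ¬ Function.Injective f := fun hinj =>
      absurd (Nat.card_le_card_of_injective f hinj) (not_le.2 h)
    simp only [Function.Injective, not_forall] at this
    obtain ⟨c, d, hcd, hne⟩ := this
    induction c using SimpleGraph.ConnectedComponent.ind with | _ a
    induction d using SimpleGraph.ConnectedComponent.ind with | _ b
    rw [hf, hf, SimpleGraph.ConnectedComponent.eq] at hcd
    rw [SimpleGraph.ConnectedComponent.eq, reachable_induce_compl_iff] at hne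
    exact ⟨a, b, a.2, b.2, hcd, hne⟩
  · rintro ⟨a, b, ha, hb, hab, hn⟩
    have hsurj : Function.Surjective f := by
      intro c
      induction c using SimpleGraph.ConnectedComponent.ind with | _ u
      by_cases hu : u = v
      · subst hu
        refine ⟨SimpleGraph.connectedComponentMk _ ⟨a, ha⟩, ?_⟩
        rw [hf, SimpleGraph.ConnectedComponent.eq]
        by_contra h
        exact hn (.of_not_reachable hab h)
      · exact ⟨SimpleGraph.connectedComponentMk _ ⟨u, hu⟩, hf _⟩
    have hninj : ¬ Function.Injective f := by
      intro hinj
      have : f (SimpleGraph.connectedComponentMk _ ⟨a, ha⟩) =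
          f (SimpleGraph.connectedComponentMk _ ⟨b, hb⟩) := by
        rw [hf, hf, SimpleGraph.ConnectedComponent.eq]
        exact hab
      have := hinj this
      rw [SimpleGraph.ConnectedComponent.eq, reachable_induce_compl_iff] at this
      exact hn this
    by_contra h
    unfold IsCutVertex at h
    push Not at h
    have hc := le_antisymm h (Nat.card_le_card_of_surjective f hsurj)
    exact hninj ((Nat.bijective_iff_surjective_and_card f).2 ⟨hsurj, hc⟩).1

/-- Behind a cut vertex, seen from another vertex, there is a vertex that is not a cut vertex. -/
lemma exists_not_isCutVertex_behind [Finite V] (x : V) {y : V} (hy : IsCutVertex G y) :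
    ∃ z, ¬ IsCutVertex G z ∧ z ≠ y ∧ G.Reachable y z ∧ ¬ AvoidReach G y x z := by
  obtain ⟨a, b, ha, hb, hab, hn⟩ := isCutVertex_iff.1 hy
  have hne : ({z | z ≠ y ∧ G.Reachable y z ∧ ¬ AvoidReach G y x z} : Set V).Nonempty := by
    have hay : G.Reachable a y := by
      by_contra h
      exact hn (.of_not_reachable hab h)
    by_cases h : AvoidReach G y x a
    · exact ⟨b, hb, hay.symm.trans hab, fun h' => hn (h.symm.trans h')⟩
    · exact ⟨a, ha, hay.symm, h⟩
  -- Among the vertices hidden behind `y`, take one farthest from `y`.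
  obtain ⟨z, ⟨hzy, hyz, hxz⟩, hmax⟩ :=
    Set.exists_max_image _ (fun z => G.dist y z) (Set.toFinite _) hne
  refine ⟨z, ?_, hzy, hyz, hxz⟩
  -- Everything else in the component stays joined to `y` without `z`. On the side of `x`, a walk to
  -- `y` cannot meet `z` before `y`. Behind `y`, a geodesic from `y` cannot pass through `z`, which
  -- is at least as far as its end.
  have key : ∀ a, a ≠ z → G.Reachable y a → AvoidReach G z y a := by
    intro a ha hya
    by_cases hay : a = y
    · exact .of_eq hay.symm hzy.symm
    by_cases h : AvoidReach G y x a
    · obtain ⟨p⟩ := hya.symm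
      rcases AvoidReach.or_of_walk hzy p with h' | h'
      · exact h'.symm
      · exact absurd (h.trans h') hxz
    · exact .of_dist_le hya ha.symm (hmax a ⟨hay, hya, h⟩)
  rw [isCutVertex_iff]
  rintro ⟨a, b, ha, hb, hab, hn⟩
  by_cases h : G.Reachable a z
  · have h1 := hyz.trans h.symm
    exact hn ((key a ha h1).symm.trans (key b hb (h1.trans hab)))
  · exact hn (.of_not_reachable hab h)

lemma exists_not_isCutVertex [Finite V] [Nonempty V] (G : SimpleGraph V) :
    ∃ z, ¬ IsCutVertex G z := by
  obtain ⟨y⟩ := ‹Nonempty V›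
  by_cases hy : IsCutVertex G y
  · obtain ⟨z, hz, -⟩ := exists_not_isCutVertex_behind y hy
    exact ⟨z, hz⟩
  · exact ⟨y, hy⟩

lemma exists_not_isCutVertex_ne [Finite V] {x y : V} (hxy : y ≠ x) :
    ∃ z, ¬ IsCutVertex G z ∧ z ≠ x := by
  by_cases hy : IsCutVertex G y
  · obtain ⟨z, hz, -, -, h⟩ := exists_not_isCutVertex_behind x hy
    exact ⟨z, hz, fun h' => h (.of_eq h'.symm hxy.symm)⟩
  · exact ⟨y, hy, hxy⟩

lemma eq_getVert_dist {x z y : V} (p : G.Walk x z) (hp : p.length = G.dist x z)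
    (hy : y ∈ p.support) : p.getVert (G.dist x y) = y := by
  classical
  have h1 : (p.takeUntil y hy).length = G.dist x y :=
    SimpleGraph.length_eq_dist_of_subwalk hp (p.isSubwalk_takeUntil hy)
  rw [← h1]
  exact SimpleGraph.Walk.getVert_length_takeUntil hy

/-- Both `y` and `y'` lie on every walk from `x` to `z`, in particular on a geodesic, which has a
single vertex at each distance from `x`. -/
lemma eq_of_not_avoidReach {x y y' z : V} (hd : G.dist x y = G.dist x y') (hz : G.Reachable x z)
    (hy : z = y ∨ ¬ AvoidReach G y x z) (hy' : z = y' ∨ ¬ AvoidReach G y' x z) : y = y' := by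
  obtain ⟨p, hp⟩ := hz.exists_walk_length_eq_dist
  have mem : ∀ {w}, (z = w ∨ ¬ AvoidReach G w x z) → w ∈ p.support := by
    rintro w (rfl | h)
    · exact p.end_mem_support
    · by_contra h'
      exact h ⟨p, h'⟩
  rw [← eq_getVert_dist p hp (mem hy), ← eq_getVert_dist p hp (mem hy'), hd]

/-- Every sphere around a vertex that is not a cut vertex has fewer elements than there are
vertices that are not cut vertices. -/
lemma card_sphere_add_one_le [Fintype V] {x : V} (hx : ¬ IsCutVertex G x) {m : ℕ}
    (hm : Fintype.card V = numCutVertices G + m) (s : Finset V) {d : ℕ} (hd : 1 ≤ d)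
    (hs : ∀ y ∈ s, G.dist x y = d) : s.card + 1 ≤ m := by
  classical
  have hnc : (Finset.univ.filter fun v => ¬ IsCutVertex G v).card = m := by
    have h1 := Finset.card_filter_add_card_filter_not (s := Finset.univ) (fun v : V => IsCutVertex G v)
    have h2 : numCutVertices G = (Finset.univ.filter fun v => IsCutVertex G v).card := by
      unfold numCutVertices
      rw [← Set.ncard_coe_finset]
      simp
    rw [Finset.card_univ] at h1
    omega
  have hxs : ∀ y ∈ s, x ≠ y ∧ G.Reachable x y := fun y hy =>
    SimpleGraph.dist_ne_zero_iff_ne_and_reachable.1 (by rw [hs y hy]; omega)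
  -- Each vertex of the sphere is assigned a non-cut vertex at it or behind it, never `x` itself.
  -- The assignment is injective by `eq_of_not_avoidReach`.
  have key : ∀ y ∈ s, ∃ z, ¬ IsCutVertex G z ∧ z ≠ x ∧ G.Reachable x z ∧
      (z = y ∨ ¬ AvoidReach G y x z) := by
    intro y hy
    obtain ⟨h1, h2⟩ := hxs y hy
    by_cases hc : IsCutVertex G y
    · obtain ⟨z, hz, -, h3, h4⟩ := exists_not_isCutVertex_behind x hc
      exact ⟨z, hz, fun h' => h4 (.of_eq h'.symm h1), h2.trans h3, Or.inr h4⟩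
    · exact ⟨y, hc, h1.symm, h2, Or.inl rfl⟩
  choose! z hz using key
  have hle : s.card ≤ ((Finset.univ.filter fun v => ¬ IsCutVertex G v).erase x).card := by
    refine Finset.card_le_card_of_injOn z ?_ ?_
    · intro y hy
      simp only [Finset.coe_erase, Finset.coe_filter, Finset.mem_univ, true_and]
      exact ⟨(hz y hy).1, (hz y hy).2.1⟩
    · intro y hy y' hy' h
      obtain ⟨-, -, h3, h4⟩ := hz y hy
      obtain ⟨-, -, -, h4'⟩ := hz y' hy'
      rw [← h] at h4'
      exact eq_of_not_avoidReach ((hs y hy).trans (hs y' hy').symm) h3 h4 h4'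
  rw [Finset.card_erase_of_mem (by simpa using hx), hnc] at hle
  have : 0 < m := hnc ▸ Finset.card_pos.2 ⟨x, by simpa using hx⟩
  omega

/-! ### Eliminating a vertex -/

/-- Elimination of the vertex `e`: it is deleted, and its neighbours are made pairwise adjacent. -/
def elim (G : SimpleGraph V) (e : V) : SimpleGraph {v // v ≠ e} where
  Adj a b := a ≠ b ∧ (G.Adj a b ∨ (G.Adj a e ∧ G.Adj e b))
  symm := ⟨fun _ _ h => ⟨h.1.symm, h.2.imp (fun h => h.symm) fun h => ⟨h.2.symm, h.1.symm⟩⟩⟩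
  loopless := ⟨fun _ h => h.1 rfl⟩

/-- A passage a, e, d becomes the edge from a to d, or nothing if a = d. Such a passage uses two
steps at once, so the induction is on a bound `N` for the length. -/
lemma elim_exists_walk {e : V} (N : ℕ) : ∀ (a b : V) (ha : a ≠ e) (hb : b ≠ e) (p : G.Walk a b), p.length ≤ N →
    ∃ q : (elim G e).Walk ⟨a, ha⟩ ⟨b, hb⟩, q.length ≤ p.length ∧ ∀ c ∈ q.support, c.1 ∈ p.support := by
  induction N with
  | zero =>
    intro a b ha hb p hp
    cases p with
    | nil => exact ⟨.nil, by simp⟩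
    | cons h p => simp at hp
  | succ N ih =>
    intro a b ha hb p hp
    cases p with
    | nil => exact ⟨.nil, by simp⟩
    | @cons _ c _ h p =>
      simp only [SimpleGraph.Walk.length_cons] at hp
      by_cases hc : c = e
      · subst hc
        cases p with
        | nil => exact absurd rfl hb
        | @cons _ d _ h' p =>
          simp only [SimpleGraph.Walk.length_cons] at hp
          obtain ⟨q, hq, hs⟩ := ih d b h'.ne' hb p (by omega)
          by_cases had : a = d
          · subst had
            refine ⟨q, ?_, fun c hc => ?_⟩
            · simp only [SimpleGraph.Walk.length_cons]
              omega
            · have := hs c hc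
              simp [this]
          · have hadj : (elim G c).Adj ⟨a, ha⟩ ⟨d, h'.ne'⟩ :=
              ⟨fun h => had (congrArg Subtype.val h), Or.inr ⟨h, h'⟩⟩
            refine ⟨.cons hadj q, ?_, fun c hc => ?_⟩
            · simp only [SimpleGraph.Walk.length_cons]
              omega
            · rw [SimpleGraph.Walk.support_cons, List.mem_cons] at hc
              rcases hc with rfl | hc
              · simp
              · have := hs c hc
                simp [this]
      · obtain ⟨q, hq, hs⟩ := ih c b hc hb p (by omega)
        have hadj : (elim G e).Adj ⟨a, ha⟩ ⟨c, hc⟩ :=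
          ⟨fun h' => h.ne (congrArg Subtype.val h'), Or.inl h⟩
        refine ⟨.cons hadj q, ?_, fun c hc => ?_⟩
        · simp only [SimpleGraph.Walk.length_cons]
          omega
        · rw [SimpleGraph.Walk.support_cons, List.mem_cons] at hc
          rcases hc with rfl | hc
          · simp
          · have := hs c hc
            simp [this]

lemma elim_reachable_iff {e : V} {a b : {v // v ≠ e}} :
    (elim G e).Reachable a b ↔ G.Reachable a b := by
  constructor
  · rintro ⟨p⟩
    induction p with
    | nil => rfl
    | cons h p ih =>
      refine .trans ?_ ih
      rcases h.2 with h | ⟨h, h'⟩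
      · exact h.reachable
      · exact h.reachable.trans h'.reachable
  · rintro ⟨p⟩
    obtain ⟨q, -⟩ := elim_exists_walk _ a.1 b.1 a.2 b.2 p le_rfl
    exact ⟨q⟩

lemma elim_dist_le {e : V} {a b : {v // v ≠ e}} (h : G.Reachable a b) :
    (elim G e).dist a b ≤ G.dist a b := by
  obtain ⟨p, hp⟩ := h.exists_walk_length_eq_dist
  obtain ⟨q, hq, -⟩ := elim_exists_walk _ a.1 b.1 a.2 b.2 p le_rfl
  exact (SimpleGraph.dist_le q).trans (hq.trans hp.le)

lemma elim_avoidReach_iff {e : V} {a b c : {v // v ≠ e}} :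
    AvoidReach (elim G e) c a b ↔ AvoidReach G c a b := by
  constructor
  · rintro ⟨p, hp⟩
    induction p with
    | nil => exact .refl fun h => hp (by simp [Subtype.ext h])
    | @cons a d b h p ih =>
      simp only [SimpleGraph.Walk.support_cons, List.mem_cons, not_or] at hp
      have h1 := ih hp.2
      refine .trans ?_ h1
      have hac : a.1 ≠ c.1 := fun h => hp.1 (Subtype.ext h.symm)
      rcases h.2 with h | ⟨h, h'⟩
      · exact .of_adj h hac h1.ne_left
      · exact (AvoidReach.of_adj h hac c.2.symm).trans (.of_adj h' c.2.symm h1.ne_left)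
  · rintro ⟨p, hp⟩
    obtain ⟨q, -, hq⟩ := elim_exists_walk _ a.1 b.1 a.2 b.2 p le_rfl
    exact ⟨q, fun h => hp (hq _ h)⟩

lemma isCutVertex_of_elim [Finite V] {e : V} {c : {v // v ≠ e}} (h : IsCutVertex (elim G e) c) :
    IsCutVertex G c := by
  rw [isCutVertex_iff] at h ⊢
  obtain ⟨a, b, ha, hb, h1, h2⟩ := h
  exact ⟨a, b, fun h => ha (Subtype.ext h), fun h => hb (Subtype.ext h), elim_reachable_iff.1 h1,
    fun h => h2 (elim_avoidReach_iff.2 h)⟩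

/-- Separation by `c` of vertices other than `e` survives elimination, so if `c` is lost it only
separates `e` from some b. A neighbour of `e` other than `c` would still reach b without `c`, and
then so would `e`. -/
lemma adj_iff_of_not_isCutVertex_elim [Finite V] {e : V} {c : {v // v ≠ e}}
    (h : IsCutVertex G c) (h' : ¬ IsCutVertex (elim G e) c) (y : V) :
    G.Adj e y ↔ y = c := by
  rw [isCutVertex_iff] at h h'
  have key : ∀ a b, a ≠ e → b ≠ e → a ≠ c → b ≠ c → G.Reachable a b → AvoidReach G c a b := by
    intro a b ha hb hac hbc hab
    by_contra hn
    exact h' ⟨⟨a, ha⟩, ⟨b, hb⟩, fun h => hac (congrArg Subtype.val h),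
      fun h => hbc (congrArg Subtype.val h), elim_reachable_iff.2 hab,
      fun h => hn (elim_avoidReach_iff.1 h)⟩
  obtain ⟨a, b, ha, hb, hab, hn⟩ := h
  have hex : ∃ b, b ≠ c.1 ∧ G.Reachable e b ∧ ¬ AvoidReach G c e b := by
    by_cases hae : a = e
    · exact ⟨b, hb, hae ▸ hab, hae ▸ hn⟩
    by_cases hbe : b = e
    · exact ⟨a, ha, hbe ▸ hab.symm, fun h => hn (hbe ▸ h.symm)⟩
    · exact absurd (key a b hae hbe ha hb hab) hn
  obtain ⟨b, hb, hr, hn⟩ := hex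
  refine ⟨fun hy => ?_, ?_⟩
  · by_contra hyc
    have hbe : b ≠ e := fun h => hn (.of_eq h.symm c.2.symm)
    exact hn ((AvoidReach.of_adj hy c.2.symm hyc).trans
      (key y b hy.ne' hbe hyc hb (hy.symm.reachable.trans hr)))
  · rintro rfl
    obtain ⟨p⟩ := hr
    cases p with
    | nil => exact absurd (.refl c.2.symm) hn
    | @cons _ d _ h p =>
      by_contra hec
      have hdc : d ≠ c := fun hd => hec (hd ▸ h)
      have hbe : b ≠ e := fun h => hn (.of_eq h.symm c.2.symm)
      exact hn ((AvoidReach.of_adj h c.2.symm hdc).trans (key d b h.ne' hbe hdc hb ⟨p⟩))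

lemma dist_add_one_le_of_adj_iff {e c : V} (h : ∀ y, G.Adj e y ↔ y = c) {y : V} (hy : y ≠ e)
    (hr : G.Reachable e y) : G.Reachable c y ∧ G.dist c y + 1 ≤ G.dist e y := by
  obtain ⟨p, hp⟩ := hr.exists_walk_length_eq_dist
  cases p with
  | nil => exact absurd rfl hy
  | @cons _ d _ h' p =>
    obtain rfl := (h d).1 h'
    refine ⟨⟨p⟩, ?_⟩
    have := SimpleGraph.dist_le p
    simp only [SimpleGraph.Walk.length_cons] at hp
    omega

lemma numCutVertices_elim [Fintype V] {e : V} (he : ¬ IsCutVertex G e)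
    (h : ∀ c : {v // v ≠ e}, IsCutVertex G c → IsCutVertex (elim G e) c) :
    numCutVertices (elim G e) = numCutVertices G := by
  unfold numCutVertices
  rw [← Set.ncard_image_of_injective _ Subtype.val_injective]
  congr 1
  ext v
  constructor
  · rintro ⟨c, hc, rfl⟩
    exact isCutVertex_of_elim hc
  · intro hv
    have hve : v ≠ e := fun h => he (h ▸ hv)
    exact ⟨⟨v, hve⟩, h ⟨v, hve⟩ hv, rfl⟩

/-- Only one cut vertex can be lost, since a lost one is the unique neighbour of `e`. -/
lemma numCutVertices_elim_add_one [Fintype V] {e : V} (he : ¬ IsCutVertex G e) {c : {v // v ≠ e}}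
    (h : IsCutVertex G c) (h' : ¬ IsCutVertex (elim G e) c) :
    numCutVertices (elim G e) + 1 = numCutVertices G := by
  unfold numCutVertices
  rw [← Set.ncard_image_of_injective _ Subtype.val_injective,
    ← Set.ncard_sdiff_singleton_add_one (show c.1 ∈ {v | IsCutVertex G v} from h) (Set.toFinite _)]
  congr 2
  ext v
  constructor
  · rintro ⟨d, hd, rfl⟩
    refine ⟨isCutVertex_of_elim hd, ?_⟩
    rintro hdc
    rw [Set.mem_singleton_iff, ← Subtype.ext_iff] at hdc
    exact h' (hdc ▸ hd)
  · rintro ⟨hv, hvc⟩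
    have hve : v ≠ e := fun h => he (h ▸ hv)
    refine ⟨⟨v, hve⟩, ?_, rfl⟩
    by_contra hd
    have h1 := adj_iff_of_not_isCutVertex_elim h h' v
    have h2 := adj_iff_of_not_isCutVertex_elim (c := ⟨v, hve⟩) hv hd v
    exact hvc (h1.1 (h2.2 rfl))

end

/-! ### Distances, index and cut vertices of a clique with legs -/

/-- `h1` bounds the length of every walk from below; descending along `h2` produces a walk of that
length. -/
lemma dist_eq_of_potential {V : Type*} (G : SimpleGraph V) (δ : V → V → ℕ)
    (h0 : ∀ u w, δ u w = 0 ↔ u = w) (h1 : ∀ u v w, G.Adj u v → δ u w ≤ δ v w + 1)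
    (h2 : ∀ u w, δ u w ≠ 0 → ∃ v, G.Adj u v ∧ δ v w + 1 = δ u w) (u w : V) :
    G.dist u w = δ u w := by
  have lower : ∀ {u w} (p : G.Walk u w), δ u w ≤ p.length := by
    intro u w p
    induction p with
    | nil => simp [(h0 _ _).2 rfl]
    | cons h p ih => exact (h1 _ _ _ h).trans (Nat.succ_le_succ ih)
  have upper : ∀ (N : ℕ) (u w : V), δ u w = N → ∃ p : G.Walk u w, p.length = N := by
    intro N
    induction N with
    | zero =>
      intro u w h
      obtain rfl := (h0 _ _).1 h
      exact ⟨.nil, rfl⟩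
    | succ N ih =>
      intro u w h
      obtain ⟨v, hv, h'⟩ := h2 u w (by omega)
      obtain ⟨p, hp⟩ := ih v w (by omega)
      exact ⟨.cons hv p, by simp [hp]⟩
  obtain ⟨p, hp⟩ := upper _ u w rfl
  obtain ⟨q, hq⟩ := SimpleGraph.Reachable.exists_walk_length_eq_dist ⟨p⟩
  have := lower q
  have := SimpleGraph.dist_le p
  omega

lemma dist_map_iso_le {V W : Type*} {G : SimpleGraph V} {H : SimpleGraph W} (e : G ≃g H) {a b : V}
    (h : G.Reachable a b) : H.dist (e a) (e b) ≤ G.dist a b := by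
  obtain ⟨p, hp⟩ := h.exists_walk_length_eq_dist
  rw [← hp, ← SimpleGraph.Walk.length_map e.toHom p]
  exact SimpleGraph.dist_le (p.map e.toHom)

lemma dist_map_iso {V W : Type*} {G : SimpleGraph V} {H : SimpleGraph W} (e : G ≃g H) (a b : V) :
    H.dist (e a) (e b) = G.dist a b := by
  by_cases h : G.Reachable a b
  · have h1 := dist_map_iso_le e.symm (e.reachable_iff.2 h)
    rw [e.symm_apply_apply, e.symm_apply_apply] at h1
    exact le_antisymm (dist_map_iso_le e h) h1
  · rw [SimpleGraph.dist_eq_zero_of_not_reachable h,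
      SimpleGraph.dist_eq_zero_of_not_reachable fun h' => h (e.reachable_iff.1 h')]

lemma hararyIndex_eq_of_iso {V W : Type*} [Fintype V] [Fintype W] {G : SimpleGraph V}
    {H : SimpleGraph W} (e : G ≃g H) : hararyIndex G = hararyIndex H := by
  unfold hararyIndex
  rw [← Equiv.sum_comp e.toEquiv]
  congr 1
  refine Finset.sum_congr rfl fun a _ => ?_
  rw [← Equiv.sum_comp e.toEquiv]
  refine Finset.sum_congr rfl fun b _ => ?_
  rw [← dist_map_iso e]
  rfl

section
variable {m : ℕ}

lemma dist_completeWithPaths (l : Fin m → ℕ) (x y : Σ i : Fin m, Fin (l i + 1)) :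
    (completeWithPaths l).dist x y = if x.1 = y.1 then
      (x.2.val - y.2.val) + (y.2.val - x.2.val) else x.2.val + y.2.val + 1 := by
  refine dist_eq_of_potential (completeWithPaths l) (fun x y => if x.1 = y.1 then
      (x.2.val - y.2.val) + (y.2.val - x.2.val) else x.2.val + y.2.val + 1) ?_ ?_ ?_ x y
  · rintro ⟨i, a⟩ ⟨j, b⟩
    by_cases h : i = j
    · subst h
      simp only [if_true, Sigma.mk.injEq, heq_eq_eq, true_and, Fin.ext_iff]
      omega
    · simp [h]
  · rintro ⟨i, a⟩ ⟨i', a'⟩ ⟨j, b⟩ (⟨h, h1, h2⟩ | ⟨h, h'⟩) <;> dsimp only at *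
    · split_ifs <;> omega
    · subst h
      split_ifs <;> omega
  · rintro ⟨i, a⟩ ⟨j, b⟩ hne
    dsimp only at hne ⊢
    by_cases h : i = j
    · subst h
      simp only [if_true] at hne ⊢
      rcases lt_or_ge a.val b.val with hab | hab
      · refine ⟨⟨i, ⟨a.val + 1, by omega⟩⟩, Or.inr ⟨rfl, Or.inl rfl⟩, ?_⟩
        simp only [if_true]
        omega
      · refine ⟨⟨i, ⟨a.val - 1, by omega⟩⟩, Or.inr ⟨rfl, Or.inr ?_⟩, ?_⟩
        · dsimp only
          omega
        · simp only [if_true]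
          omega
    · simp only [if_neg h] at hne ⊢
      by_cases ha : a.val = 0
      · refine ⟨⟨j, 0⟩, Or.inl ⟨h, ha, rfl⟩, ?_⟩
        simp [ha]
      · refine ⟨⟨i, ⟨a.val - 1, by omega⟩⟩, Or.inr ⟨rfl, Or.inr ?_⟩, ?_⟩
        · dsimp only
          omega
        · simp only [if_neg h]
          omega

/-- With truncated subtraction the summand is the inverse of |s - u|. A last row and a last column,
each with sum `harm t`, are added at every step. -/
lemma sum_inv_sub (t : ℕ) :
    ∑ s ∈ Finset.range t, ∑ u ∈ Finset.range t, (((s - u + (u - s) : ℕ) : ℝ))⁻¹ =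
      2 * pathIndex t := by
  induction t with
  | zero => simp [pathIndex]
  | succ t ih =>
    have h1 : ∑ s ∈ Finset.range t, (((s - t + (t - s) : ℕ) : ℝ))⁻¹ = harm t := by
      unfold harm
      rw [← Finset.sum_range_reflect]
      refine Finset.sum_congr rfl fun s hs => ?_
      rw [Finset.mem_range] at hs
      rw [show t - 1 - s - t + (t - (t - 1 - s)) = s + 1 by omega]
      push_cast
      rfl
    have h2 : ∑ u ∈ Finset.range t, (((t - u + (u - t) : ℕ) : ℝ))⁻¹ = harm t := by
      rw [← h1]
      exact Finset.sum_congr rfl fun u _ => by rw [add_comm (t - u)]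
    rw [Finset.sum_range_succ, Finset.sum_range_succ _ t, h2]
    simp only [Finset.sum_range_succ _ t, Finset.sum_add_distrib]
    rw [ih, h1, pathIndex_succ]
    simp
    ring

theorem hararyIndex_completeWithPaths (l : Fin m → ℕ) :
    hararyIndex (completeWithPaths l) = legIndex l := by
  unfold hararyIndex legIndex
  have h : ∀ i j : Fin m, ∑ a : Fin (l i + 1), ∑ b : Fin (l j + 1),
      (((completeWithPaths l).dist ⟨i, a⟩ ⟨j, b⟩ : ℕ) : ℝ)⁻¹ =
      (if i = j then 2 * pathIndex (l i + 1) else 0) +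
        if i = j then 0 else crossIndex (l i) (l j) := by
    intro i j
    simp only [dist_completeWithPaths]
    by_cases hij : i = j
    · subst hij
      simp only [if_true, add_zero]
      rw [← sum_inv_sub, ← Fin.sum_univ_eq_sum_range (fun s =>
        ∑ u ∈ Finset.range (l i + 1), (((s - u + (u - s) : ℕ) : ℝ))⁻¹)]
      refine Finset.sum_congr rfl fun a _ => ?_
      exact Fin.sum_univ_eq_sum_range (fun u => (((a.val - u + (u - a.val) : ℕ) : ℝ))⁻¹) _
    · simp only [if_neg hij, zero_add]
      unfold crossIndex
      rw [← Fin.sum_univ_eq_sum_range (fun s =>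
        ∑ u ∈ Finset.range (l j + 1), ((s : ℝ) + u + 1)⁻¹)]
      refine Finset.sum_congr rfl fun a _ => ?_
      rw [← Fin.sum_univ_eq_sum_range (fun u => ((a.val : ℝ) + u + 1)⁻¹)]
      push_cast
      rfl
  simp only [Fintype.sum_sigma]
  have h' : ∀ i, ∑ a : Fin (l i + 1), ∑ j, ∑ b : Fin (l j + 1),
      (((completeWithPaths l).dist ⟨i, a⟩ ⟨j, b⟩ : ℕ) : ℝ)⁻¹ = 2 * pathIndex (l i + 1) +
        ∑ j, if i = j then 0 else crossIndex (l i) (l j) := by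
    intro i
    rw [Finset.sum_comm]
    simp only [h, Finset.sum_add_distrib]
    simp
  simp only [h', Finset.sum_add_distrib, ← Finset.mul_sum]
  ring

lemma isCutVertex_completeWithPaths_iff (hm : 2 ≤ m) (l : Fin m → ℕ)
    (x : Σ i : Fin m, Fin (l i + 1)) :
    IsCutVertex (completeWithPaths l) x ↔ x.2.val < l x.1 := by
  rw [isCutVertex_iff]
  constructor
  · rintro ⟨a, b, ha, hb, -, hn⟩
    by_contra hx
    apply hn
    -- Here `x` is the end of its leg, so no other vertex meets it on the way down to the clique.
    have down : ∀ (N : ℕ) (y : Σ i : Fin m, Fin (l i + 1)), y ≠ x → y.2.val = N →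
        AvoidReach (completeWithPaths l) x y ⟨y.1, 0⟩ := by
      intro N
      induction N with
      | zero =>
        rintro ⟨i, a⟩ hy h
        obtain rfl : a = 0 := Fin.ext h
        exact .refl hy
      | succ N ih =>
        rintro ⟨i, a⟩ hy h
        dsimp only at h
        have hne : (⟨i, ⟨N, by omega⟩⟩ : Σ i : Fin m, Fin (l i + 1)) ≠ x := by
          intro h'
          rw [← h'] at hx
          dsimp only at hx
          omega
        have hadj : (completeWithPaths l).Adj ⟨i, a⟩ ⟨i, ⟨N, by omega⟩⟩ :=
          Or.inr ⟨rfl, Or.inr h.symm⟩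
        exact .trans (.of_adj hadj hy hne) (ih _ hne rfl)
    have h1 := down _ a ha rfl
    have h2 := down _ b hb rfl
    refine h1.trans (.trans ?_ h2.symm)
    by_cases hab : a.1 = b.1
    · exact .of_eq (by rw [hab]) h1.ne_right
    · exact .of_adj (Or.inl ⟨hab, rfl, rfl⟩) h1.ne_right h2.ne_right
  · intro hx
    obtain ⟨i, a⟩ := x
    dsimp only at hx
    obtain ⟨j, hj⟩ : ∃ j : Fin m, j ≠ i := by
      have : Nontrivial (Fin m) := Fin.nontrivial_iff_two_le.2 hm
      exact exists_ne i
    refine ⟨⟨i, ⟨a.val + 1, by omega⟩⟩, ⟨j, 0⟩, ?_, ?_, ?_, ?_⟩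
    · intro h
      simp only [Sigma.mk.injEq, heq_eq_eq, true_and, Fin.ext_iff] at h
      omega
    · intro h
      exact hj (congrArg Sigma.fst h)
    · refine SimpleGraph.Reachable.of_dist_ne_zero ?_
      rw [dist_completeWithPaths]
      simp [hj.symm]
    · rintro ⟨p, hp⟩
      -- A walk that starts beyond `a` on leg `i` and avoids `a` stays beyond it.
      have key : ∀ (u v : Σ i : Fin m, Fin (l i + 1)) (p : (completeWithPaths l).Walk u v),
          (⟨i, a⟩ : Σ i : Fin m, Fin (l i + 1)) ∉ p.support → u.1 = i → a.val < u.2.val →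
            v.1 = i := by
        intro u v p
        induction p with
        | nil => exact fun _ h _ => h
        | @cons u w v h p ih =>
          intro hp hu ha
          simp only [SimpleGraph.Walk.support_cons, List.mem_cons, not_or] at hp
          have hw : (⟨i, a⟩ : Σ i : Fin m, Fin (l i + 1)) ≠ w := by
            rintro rfl
            exact hp.2 p.start_mem_support
          rcases h with ⟨-, h, -⟩ | ⟨h, h'⟩
          · omega
          · obtain ⟨iw, aw⟩ := w
            dsimp only at h h'
            obtain rfl : iw = i := h.symm.trans hu
            refine ih hp.2 rfl ?_
            have : a.val ≠ aw.val := fun h => hw (by rw [Fin.ext h])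
            dsimp only
            omega
      exact hj (key _ _ p hp rfl (by simp))

lemma card_sigma_path (l : Fin m → ℕ) :
    Fintype.card (Σ i : Fin m, Fin (l i + 1)) = ∑ i, l i + m := by
  simp [Finset.sum_add_distrib]

lemma numCutVertices_completeWithPaths (hm : 2 ≤ m) (l : Fin m → ℕ) :
    numCutVertices (completeWithPaths l) = ∑ i, l i := by
  have h : {x | IsCutVertex (completeWithPaths l) x} =
      (Set.range fun i : Fin m => (⟨i, Fin.last (l i)⟩ : Σ i : Fin m, Fin (l i + 1)))ᶜ := by
    ext ⟨i, a⟩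
    simp only [Set.mem_ofPred_eq, isCutVertex_completeWithPaths_iff hm, Set.mem_compl_iff,
      Set.mem_range, not_exists]
    constructor
    · rintro h j hj
      obtain rfl : j = i := congrArg Sigma.fst hj
      simp only [Sigma.mk.injEq, heq_eq_eq, true_and] at hj
      rw [← hj] at h
      simp at h
    · intro h
      have : a ≠ Fin.last (l i) := fun h' => h i (by rw [h'])
      exact Fin.val_lt_last this
  unfold numCutVertices
  rw [h, Set.ncard_compl, Nat.card_eq_fintype_card, card_sigma_path, ← Set.image_univ,
    Set.ncard_image_of_injective, Set.ncard_univ]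
  · simp
  · intro i j h
    exact congrArg Sigma.fst h

/-- Permuting the paths. -/
def completeWithPathsPerm (l : Fin m → ℕ) (σ : Equiv.Perm (Fin m)) :
    completeWithPaths (l ∘ σ) ≃g completeWithPaths l where
  toEquiv := Equiv.sigmaCongrLeft (β := fun i => Fin (l i + 1)) σ
  map_rel_iff' := by
    rintro ⟨i, a⟩ ⟨j, b⟩
    simp [completeWithPaths, Equiv.sigmaCongrLeft]

/-- Leg 0 is read backwards and leg 1 forwards, so the two clique vertices get the consecutive
numbers `l 0` and `l 0 + 1`. -/
lemma exists_iso_pathGraph (l : Fin 2 → ℕ) {N : ℕ} (hN : l 0 + l 1 + 2 = N) :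
    ∃ e : completeWithPaths l ≃g SimpleGraph.pathGraph N, ∀ x,
      (e x).val = if x.1 = 0 then l 0 - x.2.val else l 0 + 1 + x.2.val := by
  have hlt : ∀ x : (Σ i : Fin 2, Fin (l i + 1)),
      (if x.1 = 0 then l 0 - x.2.val else l 0 + 1 + x.2.val) < N := by
    rintro ⟨i, a⟩
    have ha := a.2
    rcases (show i = 0 ∨ i = 1 by omega) with rfl | rfl <;> simp <;> omega
  let f : (Σ i : Fin 2, Fin (l i + 1)) → Fin N := fun x => ⟨_, hlt x⟩
  have hinj : Function.Injective f := by
    rintro ⟨i, a⟩ ⟨j, b⟩ h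
    simp only [f, Fin.mk.injEq] at h
    have ha := a.2
    have hb := b.2
    rcases (show i = 0 ∨ i = 1 by omega) with rfl | rfl <;>
      rcases (show j = 0 ∨ j = 1 by omega) with rfl | rfl <;> simp [Fin.ext_iff] at h ⊢ <;> omega
  have hbij : Function.Bijective f := by
    rw [Fintype.bijective_iff_injective_and_card]
    refine ⟨hinj, ?_⟩
    rw [card_sigma_path]
    simp [hN]
  refine ⟨⟨Equiv.ofBijective f hbij, ?_⟩, fun x => rfl⟩
  rintro ⟨i, a⟩ ⟨j, b⟩
  rw [SimpleGraph.pathGraph_adj]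
  have ha := a.2
  have hb := b.2
  simp only [Equiv.ofBijective_apply, f, completeWithPaths]
  rcases (show i = 0 ∨ i = 1 by omega) with rfl | rfl <;>
    rcases (show j = 0 ∨ j = 1 by omega) with rfl | rfl <;> simp [-Fin.val_eq_zero_iff] <;> omega

end

/-! ### Rigidity of the clique and of the lengths -/

/-- A clique of size `m` can be moved onto the complete graph. -/
lemma exists_iso_base {m : ℕ} (hm : 1 ≤ m) (l : Fin m → ℕ) (h1 : m = 1 → ∀ i, l i = 0)
    (Q : Finset (Σ i : Fin m, Fin (l i + 1))) (hQ : Q.card = m)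
    (hadj : ∀ x ∈ Q, ∀ y ∈ Q, x ≠ y → (completeWithPaths l).Adj x y) :
    ∃ (l' : Fin m → ℕ) (e : completeWithPaths l ≃g completeWithPaths l'),
      ∀ x, x ∈ Q ↔ (e x).2.val = 0 := by
  classical
  have hbase : (∀ x ∈ Q, x.2.val = 0) → ∀ x, x ∈ Q ↔ x.2.val = 0 := by
    intro h
    have hsub : Q ⊆ Finset.univ.image fun i : Fin m => (⟨i, 0⟩ : Σ i : Fin m, Fin (l i + 1)) := by
      rintro ⟨i, a⟩ hx
      obtain rfl : a = 0 := Fin.ext (h _ hx)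
      simp
    have heq := Finset.eq_of_subset_of_card_le hsub (by
      rw [hQ]
      exact Finset.card_image_le.trans (by simp))
    rintro ⟨i, a⟩
    rw [heq]
    simp only [Finset.mem_image, Finset.mem_univ, true_and, Sigma.mk.injEq]
    constructor
    · rintro ⟨j, rfl, h⟩
      rw [heq_eq_eq] at h
      rw [← h]
      rfl
    · intro h
      exact ⟨i, rfl, by rw [heq_eq_eq]; exact Fin.ext h.symm⟩
  -- For `m = 1` the hypothesis `h1` leaves a single vertex. For `m = 2` the graph is a path, and
  -- any of its edges can serve as the base. For `m ≥ 3` the clique contains a triangle through each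
  -- of its vertices, and a triangle cannot leave the base.
  obtain rfl | rfl | h3 : m = 1 ∨ m = 2 ∨ 3 ≤ m := by omega
  · refine ⟨l, SimpleGraph.Iso.refl, hbase ?_⟩
    rintro ⟨i, a⟩ -
    have := h1 rfl i
    have := a.2
    dsimp only
    omega
  · obtain ⟨e, he⟩ := exists_iso_pathGraph l rfl
    obtain ⟨x, y, hxy, rfl⟩ := Finset.card_eq_two.1 hQ
    have hxa := hadj x (by simp) y (by simp) hxy
    wlog hlt : (e x).val + 1 = (e y).val generalizing x y
    · obtain h := SimpleGraph.pathGraph_adj.1 (e.map_adj_iff.2 hxa)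
      have hlt' : (e y).val + 1 = (e x).val := by
        rcases h with h | h
        · exact absurd h hlt
        · exact h
      have := this y x hxy.symm (by rwa [Finset.pair_comm]) (by rwa [Finset.pair_comm])
        (by rwa [Finset.pair_comm]) hxa.symm hlt'
      rwa [Finset.pair_comm]
    have hy := (e y).2
    -- The new lengths are the numbers of vertices before and after the edge from `x` to `y` along
    -- the path.
    obtain ⟨e', he'⟩ := exists_iso_pathGraph ![(e x).val, l 0 + l 1 - (e x).val]
      (N := l 0 + l 1 + 2) (by simp; omega)
    refine ⟨_, e.trans e'.symm, fun z => ?_⟩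
    have hz : e' (e'.symm (e z)) = e z := e'.apply_symm_apply _
    have h2 : (e.trans e'.symm) z = e'.symm (e z) := rfl
    rw [h2]
    generalize e'.symm (e z) = w at hz
    have h3 := he' w
    rw [hz] at h3
    have h4 : z ∈ ({x, y} : Finset _) ↔ (e z).val = (e x).val ∨ (e z).val = (e x).val + 1 := by
      rw [hlt, ← Fin.ext_iff, ← Fin.ext_iff, e.injective.eq_iff, e.injective.eq_iff]
      simp
    rw [h4, h3]
    obtain ⟨i, a⟩ := w
    have ha := a.2
    rcases (show i = 0 ∨ i = 1 by omega) with rfl | rfl <;>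
      simp [-Fin.val_eq_zero_iff] at ha ⊢ <;> omega
  · refine ⟨l, SimpleGraph.Iso.refl, hbase ?_⟩
    intro x hx
    by_contra hx0
    have hc : 2 ≤ (Q.erase x).card := by
      rw [Finset.card_erase_of_mem hx]
      omega
    obtain ⟨y, z, hy, hz, hyz⟩ := Finset.one_lt_card_iff.1 hc
    rw [Finset.mem_erase] at hy hz
    have h1 := hadj x hx y hy.2 hy.1.symm
    have h2 := hadj x hx z hz.2 hz.1.symm
    have h3 := hadj y hy.2 z hz.2 hyz
    simp only [completeWithPaths] at h1 h2 h3
    rcases h1 with h1 | h1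
    · omega
    rcases h2 with h2 | h2
    · omega
    have : y.1 = z.1 := h1.1.symm.trans h2.1
    rcases h3 with h3 | h3
    · exact h3.1 this
    · omega

theorem nonempty_iso_of_almostEqual {m : ℕ} (hm : 2 ≤ m) {l l₁ : Fin m → ℕ} (h : AlmostEqual l)
    (hs : ∑ i, l₁ i = ∑ i, l i) (h₁ : legIndex l₁ = legIndex l) :
    Nonempty (completeWithPaths l₁ ≃g completeWithPaths l) := by
  obtain rfl | h3 : m = 2 ∨ 3 ≤ m := by omega
  · simp only [Fin.sum_univ_two] at hs
    obtain ⟨e, -⟩ := exists_iso_pathGraph l rfl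
    obtain ⟨e₁, -⟩ := exists_iso_pathGraph l₁ (N := l 0 + l 1 + 2) (by omega)
    exact ⟨e₁.trans e.symm⟩
  · obtain ⟨σ, rfl⟩ := h.exists_perm ((legIndex_le l₁ l h hs).2 h3 h₁) hs.symm
    exact ⟨completeWithPathsPerm l σ⟩

/-! ### Graphs with a tail -/

open Classical in
/-- The contribution of the pairs formed by `y` and one of `t` further vertices that form a path
attached at `x`. -/
noncomputable def tailWeight {V : Type*} (G : SimpleGraph V) (t : ℕ) (x y : V) : ℝ :=
  if G.Reachable x y then ∑ s ∈ Finset.range t, ((s : ℝ) + 1 + G.dist x y)⁻¹ else 0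

/-- The Harary index of the graph obtained from `G` by attaching a path with `t` edges at `x`. -/
noncomputable def tailIndex {V : Type*} [Fintype V] (G : SimpleGraph V) (t : ℕ) (x : V) : ℝ :=
  hararyIndex G + ∑ y, tailWeight G t x y + pathIndex t

/-- The weight of a vertex at distance `d` from the end of a path with `t` edges. -/
noncomputable def levelWeight (t d : ℕ) : ℝ :=
  ∑ s ∈ Finset.range (t + 1), ((s : ℝ) + (max d 1 : ℕ))⁻¹

/-- The truncation `max d 1` is needed at `d = 0`, where the term `s = 0` would otherwise be `0⁻¹ =
0`. -/
lemma levelWeight_anti (t : ℕ) {d d' : ℕ} (h : d ≤ d') : levelWeight t d' ≤ levelWeight t d := by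
  refine Finset.sum_le_sum fun s _ => ?_
  have h1 : ((max d 1 : ℕ) : ℝ) ≤ (max d' 1 : ℕ) := by exact_mod_cast max_le_max_right 1 h
  have h2 : (0 : ℝ) < (max d 1 : ℕ) := by exact_mod_cast lt_max_of_lt_right one_pos
  gcongr

lemma levelWeight_two_lt (t : ℕ) : levelWeight t 2 < levelWeight t 1 := by
  refine Finset.sum_lt_sum_of_nonempty (by simp) fun s _ => ?_
  norm_num
  gcongr
  norm_num

lemma levelWeight_pos (t d : ℕ) : 0 < levelWeight t d := by
  refine Finset.sum_pos (fun s _ => ?_) (by simp)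
  have h2 : (0 : ℝ) < (max d 1 : ℕ) := by exact_mod_cast lt_max_of_lt_right one_pos
  positivity

section
variable {V : Type*} {G : SimpleGraph V}

lemma tailWeight_succ {t : ℕ} {x y : V} (h : G.Reachable x y) :
    tailWeight G (t + 1) x y = levelWeight t (G.dist x y + 1) := by
  unfold tailWeight levelWeight
  rw [if_pos h]
  refine Finset.sum_congr rfl fun s _ => ?_
  rw [max_eq_left (by omega)]
  push_cast
  ring

/-- Counted together, `x` and its tail are `t + 1` vertices at consecutive distances from `y`,
beginning with that of `x`. -/
lemma inv_dist_add_tailWeight {t : ℕ} {x y : V} (hxy : x ≠ y) (h : G.Reachable x y) :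
    (G.dist x y : ℝ)⁻¹ + tailWeight G t x y = levelWeight t (G.dist x y) := by
  unfold tailWeight levelWeight
  rw [if_pos h, Finset.sum_range_succ', max_eq_left (h.pos_dist_of_ne hxy)]
  push_cast
  rw [zero_add, add_comm]

lemma inv_dist_add_tailWeight_of_not {t : ℕ} {x y : V} (h : ¬ G.Reachable x y) :
    (G.dist x y : ℝ)⁻¹ + tailWeight G t x y = 0 := by
  unfold tailWeight
  rw [if_neg h, SimpleGraph.dist_eq_zero_of_not_reachable h]
  simp

lemma tailWeight_self (G : SimpleGraph V) (t : ℕ) (x : V) : tailWeight G t x x = harm t := by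
  unfold tailWeight harm
  rw [if_pos (SimpleGraph.Reachable.refl x)]
  simp

lemma adj_iff_of_inv_dist_eq {x : V} {a b : {v // v ≠ x}}
    (h : (G.dist a b : ℝ)⁻¹ = ((elim G x).dist a b : ℝ)⁻¹) :
    G.Adj a b ↔ (elim G x).Adj a b := by
  rw [inv_inj, Nat.cast_inj] at h
  rw [← SimpleGraph.dist_eq_one_iff_adj, ← SimpleGraph.dist_eq_one_iff_adj, h]

variable [Fintype V]

lemma tailIndex_zero (G : SimpleGraph V) (x : V) : tailIndex G 0 x = hararyIndex G := by
  simp [tailIndex, tailWeight, pathIndex]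

-- The pairs are split into those without `x` and its tail, those with one vertex there, and those
-- inside the path of `t + 1` vertices formed by `x` and its tail.
open Classical in
lemma tailIndex_eq (G : SimpleGraph V) (t : ℕ) (x : V) :
    tailIndex G t x = (1 / 2) * ∑ a : {v // v ≠ x}, ∑ b : {v // v ≠ x}, (G.dist a b : ℝ)⁻¹ +
      ∑ y : {v // v ≠ x}, ((G.dist x y : ℝ)⁻¹ + tailWeight G t x y) + pathIndex (t + 1) := by
  unfold tailIndex hararyIndex
  rw [Fintype.sum_eq_add_sum_subtype_ne _ x, Fintype.sum_eq_add_sum_subtype_ne _ x,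
    Fintype.sum_eq_add_sum_subtype_ne (tailWeight G t x) x, tailWeight_self, pathIndex_succ]
  simp only [Fintype.sum_eq_add_sum_subtype_ne (fun b => (G.dist _ b : ℝ)⁻¹) x,
    Finset.sum_add_distrib, SimpleGraph.dist_self, SimpleGraph.dist_comm (v := x)]
  simp
  ring

lemma inv_dist_le_elim {x : V} (a b : {v // v ≠ x}) :
    (G.dist a b : ℝ)⁻¹ ≤ ((elim G x).dist a b : ℝ)⁻¹ := by
  by_cases hr : G.Reachable a b
  · by_cases hab : a = b
    · subst hab
      simp
    have h1 := elim_dist_le (e := x) hr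
    have h2 := (elim_reachable_iff.2 hr).pos_dist_of_ne hab
    gcongr
  · rw [SimpleGraph.dist_eq_zero_of_not_reachable hr]
    simp

-- No distance grows under elimination. If the sums agree, every distance does, and in particular
-- the pairs at distance one.
open Classical in
lemma sum_inv_dist_le_elim (x : V) :
    (1 / 2) * ∑ a : {v // v ≠ x}, ∑ b : {v // v ≠ x}, (G.dist a b : ℝ)⁻¹ ≤
        hararyIndex (elim G x) ∧
      ((1 / 2) * ∑ a : {v // v ≠ x}, ∑ b : {v // v ≠ x}, (G.dist a b : ℝ)⁻¹ =
        hararyIndex (elim G x) → ∀ a b : {v // v ≠ x}, G.Adj a b ↔ (elim G x).Adj a b) := by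
  unfold hararyIndex
  have hle : ∀ a ∈ (Finset.univ : Finset {v // v ≠ x}),
      ∑ b : {v // v ≠ x}, (G.dist a b : ℝ)⁻¹ ≤
        ∑ b : {v // v ≠ x}, ((elim G x).dist a b : ℝ)⁻¹ := fun a _ =>
    Finset.sum_le_sum fun b _ => inv_dist_le_elim a b
  constructor
  · exact mul_le_mul_of_nonneg_left (Finset.sum_le_sum hle) (by norm_num)
  · intro h a b
    have h1 := (Finset.sum_eq_sum_iff_of_le hle).1 (mul_left_cancel₀ (by norm_num) h) a
      (Finset.mem_univ _)
    have h2 := (Finset.sum_eq_sum_iff_of_le fun b _ => inv_dist_le_elim a b).1 h1 b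
      (Finset.mem_univ _)
    exact adj_iff_of_inv_dist_eq h2

-- A pendant vertex `x` becomes the first vertex of the tail at its neighbour `c`.
open Classical in
lemma tailIndex_le_elim {x : V} (t : ℕ) {c : {v // v ≠ x}} (h : ∀ y, G.Adj x y ↔ y = c) :
    tailIndex G t x ≤ tailIndex (elim G x) (t + 1) c := by
  rw [tailIndex_eq, tailIndex]
  have h1 := (sum_inv_dist_le_elim (G := G) x).1
  have h2 : ∑ y : {v // v ≠ x}, ((G.dist x y : ℝ)⁻¹ + tailWeight G t x y) ≤
      ∑ y, tailWeight (elim G x) (t + 1) c y := by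
    refine Finset.sum_le_sum fun y _ => ?_
    by_cases hr : G.Reachable x y
    · obtain ⟨h3, h4⟩ := dist_add_one_le_of_adj_iff h y.2 hr
      have h5 := elim_dist_le (e := x) h3
      rw [inv_dist_add_tailWeight y.2.symm hr, tailWeight_succ (elim_reachable_iff.2 h3)]
      exact levelWeight_anti _ (by omega)
    · rw [inv_dist_add_tailWeight_of_not hr]
      unfold tailWeight
      split_ifs
      · positivity
      · exact le_rfl
  linarith

open Classical in
lemma sum_level_le {x : V} (t : ℕ) (hx : ¬ IsCutVertex G x) {m : ℕ}
    (hm : Fintype.card V = numCutVertices G + (m + 1)) (l : Fin m → ℕ) (hl : AlmostEqual l)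
    (hs : ∑ i, l i = numCutVertices G) :
    ∑ y : {v // v ≠ x}, ((G.dist x y : ℝ)⁻¹ + tailWeight G t x y) ≤ ∑ j, crossIndex t (l j) ∧
      (∑ y : {v // v ≠ x}, ((G.dist x y : ℝ)⁻¹ + tailWeight G t x y) = ∑ j, crossIndex t (l j) →
        (Finset.univ.filter fun y : {v // v ≠ x} => G.Adj x y).card = m) := by
  have hcross : ∑ j, crossIndex t (l j) =
      ∑ j, ∑ b ∈ Finset.range (l j + 1), levelWeight t (b + 1) := by
    rw [sum_crossIndex]
    refine Finset.sum_congr rfl fun j _ => Finset.sum_congr rfl fun b _ => ?_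
    unfold levelWeight
    rw [max_eq_left (by omega)]
  have hcard : Fintype.card {v // v ≠ x} = Fintype.card V - 1 := by simp
  -- Unreachable vertices are put on level `Fintype.card V`, one above the levels whose size has to
  -- be bounded. Their contribution 0 is at most the positive weight there.
  let f : {v // v ≠ x} → ℕ := fun y =>
    if G.Reachable x y then G.dist x y else Fintype.card V
  have hle : ∀ y ∈ (Finset.univ : Finset {v // v ≠ x}),
      (G.dist x y : ℝ)⁻¹ + tailWeight G t x y ≤ levelWeight t (f y) := by
    intro y _
    by_cases hr : G.Reachable x y
    · rw [inv_dist_add_tailWeight y.2.symm hr]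
      simp [f, hr]
    · rw [inv_dist_add_tailWeight_of_not hr]
      exact (levelWeight_pos _ _).le
  obtain ⟨h1, h2⟩ := sum_levels_le_almostEqual l hl f (levelWeight t)
    (fun i => levelWeight_anti t (Nat.le_succ i))
    (by rw [hcard, hm, Finset.sum_add_distrib, hs]; simp)
    (fun y => by
      dsimp only [f]
      split_ifs with hr
      · exact hr.pos_dist_of_ne y.2.symm
      · omega)
    (fun i hi hi' => by
      have := card_sphere_add_one_le hx hm
        ((Finset.univ.filter fun y => f y = i).map (Function.Embedding.subtype _)) hi (by
          intro y hy
          simp only [Finset.mem_map, Finset.mem_filter, Finset.mem_univ, true_and] at hy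
          obtain ⟨y, hy, rfl⟩ := hy
          dsimp only [f] at hy
          split_ifs at hy with hr
          · exact hy
          · omega)
      rw [Finset.card_map] at this
      omega)
  have h3 := Finset.sum_le_sum hle
  rw [hcross]
  refine ⟨h3.trans h1, fun he => ?_⟩
  -- The weight drops strictly from level 1 to level 2, so equality forces level 1, the
  -- neighbourhood of `x`, to be full.
  rw [← h2 (levelWeight_two_lt t) (le_antisymm h1 (he ▸ h3))]
  congr 1
  ext y
  simp only [Finset.mem_filter, Finset.mem_univ, true_and, f]
  rw [← SimpleGraph.dist_eq_one_iff_adj]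
  split_ifs with hr
  · rfl
  · rw [SimpleGraph.dist_eq_zero_of_not_reachable hr]
    have := Fintype.card_pos_iff.2 ⟨y⟩
    omega

lemma two_le_of_ne {x y : V} (hxy : y ≠ x) (hx : ¬ IsCutVertex G x) {m : ℕ}
    (hm : Fintype.card V = numCutVertices G + m) : 2 ≤ m := by
  obtain ⟨z, hz, hzx⟩ := exists_not_isCutVertex_ne (G := G) hxy
  have h := Set.ncard_add_ncard_compl {v : V | IsCutVertex G v}
  rw [Nat.card_eq_fintype_card, hm] at h
  have h' : ({x, z} : Set V).ncard ≤ ({v : V | IsCutVertex G v}ᶜ).ncard := by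
    refine Set.ncard_le_ncard ?_ (Set.toFinite _)
    rintro v (rfl | rfl)
    · exact hx
    · exact hz
  rw [Set.ncard_pair hzx.symm] at h'
  unfold numCutVertices at h
  omega

end

/-! ### Reconstructing the extremal graph -/

/-- Coordinates that identify `G`, with a path of `t` further vertices attached at `x`, with a
complete graph with attached paths. -/
structure LegCoordinates {V : Type*} (G : SimpleGraph V) (x : V) (t : ℕ) {m : ℕ} (l : Fin m → ℕ)
    (leg : V → Fin m) (pos : V → ℕ) : Prop where
  pos_le : ∀ v, pos v ≤ l (leg v)
  pos_add_le : ∀ v, leg v = leg x → pos v + t ≤ l (leg x)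
  pos_self : pos x + t = l (leg x)
  inj : ∀ u v, leg u = leg v → pos u = pos v → u = v
  surj : ∀ j b, b ≤ l j → (j = leg x → b + t ≤ l j) → ∃ v, leg v = j ∧ pos v = b
  adj_iff : ∀ u v, G.Adj u v ↔ (leg u ≠ leg v ∧ pos u = 0 ∧ pos v = 0) ∨
    (leg u = leg v ∧ (pos u + 1 = pos v ∨ pos v + 1 = pos u))

lemma LegCoordinates.exists_iso {V : Type*} {G : SimpleGraph V} {x : V} {m : ℕ} {l : Fin m → ℕ}
    {leg : V → Fin m} {pos : V → ℕ} (h : LegCoordinates G x 0 l leg pos) :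
    Nonempty (G ≃g completeWithPaths l) := by
  let f : V → Σ i : Fin m, Fin (l i + 1) := fun v => ⟨leg v, ⟨pos v, Nat.lt_succ_of_le (h.pos_le v)⟩⟩
  have hf : Function.Bijective f := by
    constructor
    · intro u v huv
      have h1 : leg u = leg v := congrArg Sigma.fst huv
      have h2 : pos u = pos v := congrArg (fun z => z.2.val) huv
      exact h.inj u v h1 h2
    · rintro ⟨j, b⟩
      have hb : b.val ≤ l j := Nat.le_of_lt_succ b.2
      obtain ⟨v, rfl, hv⟩ := h.surj j b hb fun _ => hb
      exact ⟨v, by simp only [f, Sigma.mk.injEq, heq_eq_eq, true_and]; exact Fin.ext hv⟩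
  exact ⟨⟨Equiv.ofBijective f hf, fun {u v} => (h.adj_iff u v).symm⟩⟩

open Classical in
/-- Extension of a function from the complement of `e`. -/
noncomputable def extendAt {V α : Type*} (e : V) (f : {v // v ≠ e} → α) (a : α) (v : V) : α :=
  if h : v ≠ e then f ⟨v, h⟩ else a

@[simp] lemma extendAt_self {V α : Type*} (e : V) (f : {v // v ≠ e} → α) (a : α) :
    extendAt e f a e = a := by simp [extendAt]

@[simp] lemma extendAt_coe {V α : Type*} (e : V) (f : {v // v ≠ e} → α) (a : α)
    (v : {v // v ≠ e}) : extendAt e f a v = f v := by simp [extendAt, v.2]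

/-- Reversal of the pendant case: `x` takes the first of the `t + 1` places reserved beyond `c`, and
the other `t` remain for its own tail. -/
lemma LegCoordinates.extend_leg {V : Type*} {G : SimpleGraph V} {x : V} {c : {v // v ≠ x}} {t m : ℕ}
    {l : Fin m → ℕ} {leg : {v // v ≠ x} → Fin m} {pos : {v // v ≠ x} → ℕ}
    (h : LegCoordinates (elim G x) c (t + 1) l leg pos) (hc : ∀ y, G.Adj x y ↔ y = c) :
    LegCoordinates G x t l (extendAt x leg (leg c)) (extendAt x pos (pos c + 1)) := by
  have hcase : ∀ v : V, v = x ∨ ∃ w : {v // v ≠ x}, w.1 = v := fun v =>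
    (eq_or_ne v x).imp_right fun h => ⟨⟨v, h⟩, rfl⟩
  have hself := h.pos_self
  have hx : ∀ w : {v // v ≠ x}, G.Adj x w ↔ leg w = leg c ∧ pos w = pos c := by
    intro w
    rw [hc]
    constructor
    · intro hw
      rw [Subtype.ext hw]
      exact ⟨rfl, rfl⟩
    · exact fun hw => congrArg Subtype.val (h.inj _ _ hw.1 hw.2)
  have hxw : ∀ w : {v // v ≠ x}, G.Adj x w ↔ (leg c ≠ leg w ∧ pos c + 1 = 0 ∧ pos w = 0) ∨
      (leg c = leg w ∧ (pos c + 1 + 1 = pos w ∨ pos w + 1 = pos c + 1)) := by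
    intro w
    rw [hx]
    have := h.pos_add_le w
    constructor
    · rintro ⟨h1, h2⟩
      exact Or.inr ⟨h1.symm, Or.inr (by rw [h2])⟩
    · rintro (⟨-, h1, -⟩ | ⟨h1, h2⟩)
      · omega
      · have := this h1.symm
        exact ⟨h1.symm, by omega⟩
  constructor
  · intro v
    rcases hcase v with rfl | ⟨v, rfl⟩
    · simp only [extendAt_self]
      omega
    · simpa using h.pos_le v
  · intro v
    rcases hcase v with rfl | ⟨v, rfl⟩
    · simp only [extendAt_self]
      omega
    · simp only [extendAt_self, extendAt_coe]
      intro hv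
      have := h.pos_add_le v hv
      omega
  · simp only [extendAt_self]
    omega
  · intro u v
    rcases hcase u with rfl | ⟨u, rfl⟩ <;> rcases hcase v with rfl | ⟨v, rfl⟩ <;>
      simp only [extendAt_self, extendAt_coe]
    · exact fun _ _ => trivial
    · intro h1 h2
      have := h.pos_add_le v h1.symm
      omega
    · intro h1 h2
      have := h.pos_add_le u h1
      omega
    · intro h1 h2
      rw [h.inj u v h1 h2]
  · intro j b hb hj
    simp only [extendAt_self] at hj
    by_cases hjb : j = leg c ∧ b = pos c + 1
    · exact ⟨x, by simp [hjb.1], by simp [hjb.2]⟩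
    · obtain ⟨v, hv1, hv2⟩ := h.surj j b hb (by
        intro hjc
        have := hj hjc
        have : b ≠ pos c + 1 := fun h => hjb ⟨hjc, h⟩
        subst hjc
        omega)
      exact ⟨v, by simpa using hv1, by simpa using hv2⟩
  · intro u v
    rcases hcase u with rfl | ⟨u, rfl⟩ <;> rcases hcase v with rfl | ⟨v, rfl⟩ <;>
      simp only [extendAt_self, extendAt_coe]
    · simp
    · exact hxw v
    · rw [SimpleGraph.adj_comm, hxw]
      constructor
      · rintro (⟨h1, h2, h3⟩ | ⟨h1, h2⟩)
        · exact Or.inl ⟨h1.symm, h3, h2⟩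
        · exact Or.inr ⟨h1.symm, h2.symm⟩
      · rintro (⟨h1, h2, h3⟩ | ⟨h1, h2⟩)
        · exact Or.inl ⟨h1.symm, h3, h2⟩
        · exact Or.inr ⟨h1.symm, h2.symm⟩
    · rw [← h.adj_iff]
      constructor
      · exact fun huv => ⟨fun h => huv.ne (congrArg Subtype.val h), Or.inl huv⟩
      · rintro ⟨hne, huv | ⟨h1, h2⟩⟩
        · exact huv
        · exact absurd (Subtype.ext (((hc _).1 h1.symm).trans ((hc _).1 h2).symm)) hne

/-- Reversal of the other case: `x` is a new clique vertex, the root of a leg that consists of its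
tail. -/
lemma LegCoordinates.cons {V : Type*} {G : SimpleGraph V} {x : V} {m : ℕ}
    {l : Fin m → ℕ} (e : elim G x ≃g completeWithPaths l) (t : ℕ)
    (hG : ∀ a b : {v // v ≠ x}, G.Adj a b ↔ (elim G x).Adj a b)
    (hx : ∀ a : {v // v ≠ x}, G.Adj x a ↔ (e a).2.val = 0) :
    LegCoordinates G x t (Fin.cons t l : Fin (m + 1) → ℕ)
      (extendAt x (fun v => (e v).1.succ) 0) (extendAt x (fun v => (e v).2.val) 0) := by
  have hcase : ∀ v : V, v = x ∨ ∃ w : {v // v ≠ x}, w.1 = v := fun v =>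
    (eq_or_ne v x).imp_right fun h => ⟨⟨v, h⟩, rfl⟩
  constructor
  · intro v
    rcases hcase v with rfl | ⟨v, rfl⟩
    · simp
    · simpa using Nat.le_of_lt_succ (e v).2.2
  · intro v
    rcases hcase v with rfl | ⟨v, rfl⟩
    · simp
    · simp only [extendAt_self, extendAt_coe]
      exact fun h => absurd h (Fin.succ_ne_zero _)
  · simp
  · intro u v
    rcases hcase u with rfl | ⟨u, rfl⟩ <;> rcases hcase v with rfl | ⟨v, rfl⟩ <;>
      simp only [extendAt_self, extendAt_coe]
    · exact fun _ _ => trivial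
    · exact fun h => absurd h.symm (Fin.succ_ne_zero _)
    · exact fun h => absurd h (Fin.succ_ne_zero _)
    · intro h1 h2
      rw [Fin.succ_inj] at h1
      congr 1
      apply e.injective
      generalize e u = a at *
      generalize e v = b at *
      obtain ⟨i, a⟩ := a
      obtain ⟨j, b⟩ := b
      dsimp only at h1
      subst h1
      rw [show a = b from Fin.ext h2]
  · intro j
    refine Fin.cases ?_ (fun j => ?_) j
    · intro b _ h
      have := h (by simp)
      simp only [Fin.cons_zero] at this
      exact ⟨x, by simp, by simp; omega⟩
    · intro b hb _
      simp only [Fin.cons_succ] at hb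
      refine ⟨(e.symm ⟨j, ⟨b, Nat.lt_succ_of_le hb⟩⟩).1, ?_, ?_⟩ <;>
        rw [extendAt_coe, e.apply_symm_apply]
  · intro u v
    rcases hcase u with rfl | ⟨u, rfl⟩ <;> rcases hcase v with rfl | ⟨v, rfl⟩ <;>
      simp only [extendAt_self, extendAt_coe]
    · simp
    · rw [hx]
      simp [(Fin.succ_ne_zero _).symm]
    · rw [SimpleGraph.adj_comm, hx]
      simp [Fin.succ_ne_zero]
    · rw [hG, ← e.map_adj_iff, Fin.succ_inj, Ne, Fin.succ_inj]
      rfl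

/-! ### The induction -/

/-- The tail is carried along so that removing a pendant vertex stays inside the induction. The
lengths `l₁` obtained from equality need not be almost equal; they are compared with `l` only at the
end. -/
theorem tailIndex_le_legIndex (N : ℕ) : ∀ {V : Type*} [Fintype V] (G : SimpleGraph V) (x : V)
    (t m : ℕ) (l : Fin m → ℕ), Fintype.card V = N → ¬ IsCutVertex G x →
    Fintype.card V = numCutVertices G + m → AlmostEqual l → ∑ i, l i = numCutVertices G + t →
    tailIndex G t x ≤ legIndex l ∧ (tailIndex G t x = legIndex l →
      ∃ (l₁ : Fin m → ℕ) (leg : V → Fin m) (pos : V → ℕ), LegCoordinates G x t l₁ leg pos) := by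
  classical
  induction N with
  | zero =>
    intro V _ G x t m l hN
    exact absurd hN (Fintype.card_pos_iff.2 ⟨x⟩).ne'
  | succ N ih =>
    intro V _ G x t m l hN hx hm hl hs
    have hN' : Fintype.card {v // v ≠ x} = N := by simp [hN]
    by_cases hB : ∃ c : {v // v ≠ x}, IsCutVertex G c ∧ ¬ IsCutVertex (elim G x) c
    · obtain ⟨c, hc, hc'⟩ := hB
      have hadj := adj_iff_of_not_isCutVertex_elim hc hc'
      have hnum := numCutVertices_elim_add_one hx hc hc'
      obtain ⟨h1, h2⟩ := ih (elim G x) c (t + 1) m l hN' hc' (by omega) hl (by omega)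
      have h3 := tailIndex_le_elim t hadj
      refine ⟨h3.trans h1, fun he => ?_⟩
      obtain ⟨l₁, leg, pos, hco⟩ := h2 (le_antisymm h1 (he ▸ h3))
      exact ⟨l₁, _, _, hco.extend_leg hadj⟩
    push Not at hB
    have hnum := numCutVertices_elim hx hB
    rw [tailIndex_eq]
    by_cases hne : Nonempty {v // v ≠ x}
    · obtain ⟨x', hx'⟩ := exists_not_isCutVertex (elim G x)
      obtain ⟨m, rfl⟩ : ∃ m', m = m' + 1 := ⟨m - 1, by
        have := card_sphere_add_one_le hx hm ∅ le_rfl (by simp)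
        omega⟩
      have hm' : Fintype.card {v // v ≠ x} = numCutVertices (elim G x) + m := by omega
      have hmpos : 1 ≤ m := by
        have := card_sphere_add_one_le hx' hm' ∅ le_rfl (by simp)
        omega
      obtain ⟨l', hl', hs'⟩ := exists_almostEqual (m := m) (by omega) (numCutVertices G)
      obtain ⟨h1, h2⟩ := ih (elim G x) x' 0 m l' hN' hx' hm' hl' (by omega)
      rw [tailIndex_zero] at h1 h2
      obtain ⟨h3, h4⟩ := sum_inv_dist_le_elim (G := G) x
      obtain ⟨h5, h6⟩ := sum_level_le t hx hm l' hl' hs'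
      -- The bounds for the pairs away from `x`, across, and inside the tail add up to the index
      -- with lengths `t, l'`; this family need not be balanced, so it is compared with `l`.
      have hcons := legIndex_cons t l'
      have h7 := (legIndex_le (Fin.cons t l' : Fin (m + 1) → ℕ) l hl (by
        rw [Fin.sum_univ_succ]
        simp only [Fin.cons_zero, Fin.cons_succ]
        omega)).1
      refine ⟨by linarith, fun he => ?_⟩
      obtain ⟨l₁, leg, pos, hco⟩ := h2 (by linarith)
      obtain ⟨e⟩ := hco.exists_iso
      have hcard₁ := (Fintype.card_congr e.toEquiv).trans (card_sigma_path l₁)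
      have hG := h4 (by linarith)
      have hcard := h6 (by linarith)
      -- The `m` neighbours of `x` form a clique in `elim G x`, which is moved onto the base so that
      -- `x` enlarges the complete graph. If `m = 1`, a second vertex would give a second non-cut
      -- vertex, so the graph is one point and `l₁` vanishes.
      obtain ⟨l₂, e₂, he₂⟩ := exists_iso_base hmpos l₁ (by
          rintro rfl i
          have hsub : Fintype.card {v // v ≠ x} ≤ 1 := by
            rw [Fintype.card_le_one_iff_subsingleton]
            refine ⟨fun a b => ?_⟩
            have key : ∀ a, a = x' := by
              intro a
              by_contra ha
              have := two_le_of_ne ha hx' hm'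
              omega
            rw [key a, key b]
          have := Finset.single_le_sum (f := l₁) (by simp) (Finset.mem_univ i)
          omega)
        ((Finset.univ.filter fun y : {v // v ≠ x} => G.Adj x y).map e.toEquiv.toEmbedding)
        (by rw [Finset.card_map, hcard]) (by
          intro a ha b hb hab
          simp only [Finset.mem_map, Finset.mem_filter, Finset.mem_univ, true_and] at ha hb
          obtain ⟨a, ha, rfl⟩ := ha
          obtain ⟨b, hb, rfl⟩ := hb
          refine e.map_adj_iff.2 ⟨fun h => hab (by rw [h]), Or.inr ⟨ha.symm, hb⟩⟩)
      refine ⟨Fin.cons t l₂, _, _, LegCoordinates.cons (e.trans e₂) t hG fun a => ?_⟩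
      refine Iff.trans ?_ (he₂ (e a))
      simp only [Finset.mem_map_equiv, Finset.mem_filter, Finset.mem_univ, true_and]
      rw [show e.toEquiv.symm (e a) = a from e.symm_apply_apply a]
    · rw [not_nonempty_iff] at hne
      have h0 : Fintype.card V = 1 := by
        rw [Fintype.card_eq_zero] at hN'
        omega
      have hnum0 : numCutVertices (elim G x) = 0 := by
        unfold numCutVertices
        rw [Set.eq_empty_of_isEmpty {v | IsCutVertex (elim G x) v}, Set.ncard_empty]
      obtain rfl : m = 1 := by omega
      simp only [Fin.sum_univ_one] at hs
      have hl0 : l 0 = t := by omega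
      have hT : legIndex l = pathIndex (t + 1) := by simp [legIndex, hl0]
      rw [hT]
      refine ⟨by simp, fun _ => ⟨l, fun _ => 0, fun _ => 0, ?_⟩⟩
      have hsub := Fintype.card_le_one_iff_subsingleton.1 h0.le
      constructor
      · simp
      · simp [hl0]
      · simp [hl0]
      · exact fun u v _ _ => Subsingleton.elim u v
      · intro j b hb hj
        obtain rfl : j = 0 := Subsingleton.elim _ _
        exact ⟨x, rfl, by have := hj rfl; omega⟩
      · intro u v
        rw [Subsingleton.elim u v]
        simp

end HararyCut

theorem mainTheorem1 (n k : ℕ) (hk : k + 2 ≤ n) :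
    (∃ l : Fin (n - k) → ℕ, HararyCut.AlmostEqual l ∧ ∑ i, l i = k) ∧
    ∀ l : Fin (n - k) → ℕ, HararyCut.AlmostEqual l → ∑ i, l i = k →
      Fintype.card (Σ i : Fin (n - k), Fin (l i + 1)) = n ∧
      HararyCut.numCutVertices (HararyCut.completeWithPaths l) = k ∧
      ∀ {V : Type*} [Fintype V] (G : SimpleGraph V),
        Fintype.card V = n → HararyCut.numCutVertices G = k →
          HararyCut.hararyIndex G ≤ HararyCut.hararyIndex (HararyCut.completeWithPaths l) ∧
          (HararyCut.hararyIndex G = HararyCut.hararyIndex (HararyCut.completeWithPaths l) ↔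
            Nonempty (G ≃g HararyCut.completeWithPaths l)) := by
  refine ⟨HararyCut.exists_almostEqual (by omega) k, fun l hl hs => ⟨?_, ?_, ?_⟩⟩
  · rw [HararyCut.card_sigma_path]
    omega
  · rw [HararyCut.numCutVertices_completeWithPaths (by omega), hs]
  · intro V _ G hV hG
    have : Nonempty V := Fintype.card_pos_iff.1 (by omega)
    obtain ⟨x, hx⟩ := HararyCut.exists_not_isCutVertex G
    obtain ⟨h1, h2⟩ := HararyCut.tailIndex_le_legIndex _ G x 0 (n - k) l rfl hx (by omega) hl
      (by omega)
    rw [HararyCut.tailIndex_zero] at h1 h2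
    rw [HararyCut.hararyIndex_completeWithPaths]
    refine ⟨h1, fun h => ?_, fun ⟨e⟩ => ?_⟩
    · obtain ⟨l₁, leg, pos, hco⟩ := h2 h
      obtain ⟨e⟩ := hco.exists_iso
      have hcard := (Fintype.card_congr e.toEquiv).trans (HararyCut.card_sigma_path l₁)
      rw [HararyCut.hararyIndex_eq_of_iso e, HararyCut.hararyIndex_completeWithPaths] at h
      -- `G` is known to be a clique with legs `l₁`; having the maximal index, it must be isomorphic
      -- to the balanced one.
      obtain ⟨e'⟩ := HararyCut.nonempty_iso_of_almostEqual (by omega) hl (by omega) h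
      exact ⟨e.trans e'⟩
    · rw [HararyCut.hararyIndex_eq_of_iso e, HararyCut.hararyIndex_completeWithPaths]
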